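/- **Setting.** Let $\mathcal X$ be a measurable space with a probability distribution $\mu$, let $\rho$ be a measurable map from $\mathcal X$ to the density matrices of a finite-dimensional quantum system, let $O$ be a Hermitian observable with spectral norm $\|O\|_\infty\le 1$, $U$ a unitary, and $O^U=U^\dagger OU$. Let $k:\mathcal X\times\mathcal X\to\mathbb R$ be a measurable positive semidefinite kernel and $N\ge 1$. The inputs $x_1,\dots,x_N$ are drawn independently from $\mu$, with labels $y_i=\mathrm{Tr}(O^U\rho(x_i))$. The kernel is re-scaled by a positive factor (which may depend on the sample), still written $k$, so that its Gram matrix $K_{ij}=k(x_i,x_j)$ satisfies $\mathrm{Tr}\,K=\sum_i k(x_i,x_i)=N$. For $\lambda\ge 0$ such that $K+\lambda I$ is invertible (automatic for $\lambda>0$) let $$f(x)=\min\Big(1,\max\Big(-1,\sum_{i,j=1}^N k(x_i,x)\,((K+\lambda I)^{-1})_{ij}\,y_j\Big)\Big)$$ be the clipped kernel ridge regressor, and $$A_{\rm tra}=\lambda^2\sum_{i,j=1}^N((K+\lambda I)^{-2})_{ij}\,\rho(x_i)\otimes\rho(x_j),\qquad A_{\rm gen}=\sum_{i,j=1}^N((K+\lambda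 I)^{-1}K(K+\lambda I)^{-1})_{ij}\,\rho(x_i)\otimes\rho(x_j).$$ **Theorem.** For every $\delta_0<1$ there is a constant $C>0$, depending only on $\delta_0$, such that in every such setting the following hold. 1. For every $\lambda\ge 0$ and $0<\delta\le\delta_0$, with probability at least $1-\delta$ over the training sample: if the kernel can be re-scaled to $\mathrm{Tr}\,K=N$ and $K+\lambda I$ is invertible, then $$\mathbb E_{x\sim\mu}\big|f(x)-\mathrm{Tr}(O^U\rho(x))\big|\le C\left(\sqrt{\frac{\mathrm{Tr}(A_{\rm tra}\,O^U\otimes O^U)}{N}}+\sqrt{\frac{\mathrm{Tr}(A_{\rm gen}\,O^U\otimes O^U)}{N}}+\sqrt{\frac{\log(1/\delta)}{N}}\right).$$ 2. If $\lambda=0$ and $K$ is invertible, then $A_{\rm tra}=0$, $A_{\rm gen}=\sum_{i,j}(K^{-1})_{ij}\,\rho(x_i)\otimes\rho(x_j)$, and $\mathrm{Tr}(A_{\rm gen}\,O^U\otimes O^U)=s_K$, where $s_K=\sum_{i,j}(K^{-1})_{ij}\,\mathrm{Tr}(O^U\rho(x_i))\,\mathrm{Tr}(O^U\rho(x_j))$.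 3. For $\lambda=0$, with probability at least $0.99$: if the kernel can be re-scaled to $\mathrm{Tr}\,K=N$ and $K$ is invertible, then $$\mathbb E_{x\sim\mu}\big|f(x)-\mathrm{Tr}(O^U\rho(x))\big|\le C\sqrt{\frac{\max(1,s_K)}{N}}.$$ -/

import Mathlib

open MeasureTheory
open scoped Matrix Kronecker ComplexOrder

noncomputable section

namespace QKernel

variable {X : Type*} {d : Type*} [Fintype d] [DecidableEq d] {N : ℕ}

/-- Density matrices: the states of a quantum system with Hilbert space `ℂ^d`. -/
def IsDensityMatrix (ρ : Matrix d d ℂ) : Prop := ρ.PosSemidef ∧ ρ.trace = 1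

/-- Observables with spectral norm at most one: Hermitian matrices whose operator norm on the
Euclidean space `ℂ^d` is at most `1`. -/
def IsBoundedObservable (O : Matrix d d ℂ) : Prop :=
  O.IsHermitian ∧ ‖Matrix.toEuclideanCLM (n := d) (𝕜 := ℂ) O‖ ≤ 1

/-- The Heisenberg evolved observable `O^U = U† O U`. -/
def heisenberg (U O : Matrix d d ℂ) : Matrix d d ℂ := Uᴴ * O * U

/-- The expectation value `Tr (A ρ)` (a real number for Hermitian `A` and `ρ`). -/
def expVal (A ρ : Matrix d d ℂ) : ℝ := (A * ρ).trace.re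

/-- Real-valued positive semidefinite kernels: every finite Gram matrix is symmetric positive
semidefinite. -/
def IsKernel (k : X → X → ℝ) : Prop := (Matrix.of k : Matrix X X ℝ).PosSemidef

/-- The kernel rescaled by the number `c`. -/
def scale (c : ℝ) (k : X → X → ℝ) : X → X → ℝ := fun u v => c * k u v

/-- The Gram matrix `K i j = k (x i) (x j)` of the inputs `x`. -/
def gram (k : X → X → ℝ) (x : Fin N → X) : Matrix (Fin N) (Fin N) ℝ :=
  Matrix.of fun i j => k (x i) (x j)

/-- The regularized Gram matrix `K + lam I`. -/
def regGram (k : X → X → ℝ) (lam : ℝ) (x : Fin N → X) : Matrix (Fin N) (Fin N) ℝ :=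
  gram k x + lam • (1 : Matrix (Fin N) (Fin N) ℝ)

/-- The kernel ridge regressor with regularization `lam`, trained on the data `(x i, y i)` and with
its output clipped to `[-1, 1]`:
`u ↦ min (1, max (-1, ∑ i j, k (x i) u * ((K + lam I)⁻¹) i j * y j))`. -/
def regressor (k : X → X → ℝ) (lam : ℝ) (x : Fin N → X) (y : Fin N → ℝ) (u : X) : ℝ :=
  min 1 (max (-1) (∑ i, ∑ j, k (x i) u * ((regGram k lam x)⁻¹) i j * y j))

/-- The expected prediction error `𝔼_{u ∼ μ} |f u - Tr (A ρ u)|`, where `f` is the regressor trained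
on the data `(x i, Tr (A ρ (x i)))`. -/
def predError [MeasurableSpace X] (μ : Measure X) (ρ : X → Matrix d d ℂ) (A : Matrix d d ℂ)
    (k : X → X → ℝ) (lam : ℝ) (x : Fin N → X) : ℝ :=
  ∫ u, |regressor k lam x (fun i => expVal A (ρ (x i))) u - expVal A (ρ u)| ∂μ

/-- `∑ i j, M i j • ρ (x i) ⊗ ρ (x j)`, an operator on two copies of the quantum system. -/
def pairOperator (M : Matrix (Fin N) (Fin N) ℝ) (ρ : X → Matrix d d ℂ) (x : Fin N → X) :
    Matrix (d × d) (d × d) ℂ :=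
  ∑ i, ∑ j, ((M i j : ℝ) : ℂ) • (ρ (x i) ⊗ₖ ρ (x j))

/-- `A_tra = lam² ∑ i j, ((K + lam I)⁻²) i j • ρ (x i) ⊗ ρ (x j)`. -/
def Atra (k : X → X → ℝ) (lam : ℝ) (ρ : X → Matrix d d ℂ) (x : Fin N → X) :
    Matrix (d × d) (d × d) ℂ :=
  ((lam ^ 2 : ℝ) : ℂ) • pairOperator ((regGram k lam x)⁻¹ ^ 2) ρ x

/-- `A_gen = ∑ i j, ((K + lam I)⁻¹ K (K + lam I)⁻¹) i j • ρ (x i) ⊗ ρ (x j)`. -/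
def Agen (k : X → X → ℝ) (lam : ℝ) (ρ : X → Matrix d d ℂ) (x : Fin N → X) :
    Matrix (d × d) (d × d) ℂ :=
  pairOperator ((regGram k lam x)⁻¹ * gram k x * (regGram k lam x)⁻¹) ρ x

/-- The number `Tr (B (A ⊗ A))`, for an operator `B` on two copies of the system (real for the
operators `Atra`, `Agen` and Hermitian `A`). -/
def pairTrace (B : Matrix (d × d) (d × d) ℂ) (A : Matrix d d ℂ) : ℝ := (B * (A ⊗ₖ A)).trace.re

/-- The unregularized model complexity
`s_K = ∑ i j, (K⁻¹) i j * Tr (A ρ (x i)) * Tr (A ρ (x j))`. -/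
def sK (k : X → X → ℝ) (ρ : X → Matrix d d ℂ) (A : Matrix d d ℂ) (x : Fin N → X) : ℝ :=
  ∑ i, ∑ j, ((gram k x)⁻¹) i j * expVal A (ρ (x i)) * expVal A (ρ (x j))

end QKernel

end

/-! The test error is the training error plus a generalization gap. The residuals of ridge
regression are `-lam` times its coefficients, so Cauchy-Schwarz bounds the training error by the
`Atra` term (`sum_abs_clip_ridge_sub_le`). The regressor is a clipped linear function of the kernel
features whose squared norm is the trace against `Agen` (`sum_ridgeCoeff_mul`); the gap is
controlled by this norm times the square root of the kernel trace, a product that does not change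
when the kernel is rescaled (`pi_generalization_gap_le`).

For the gap, a ghost sample is added and the points are paired. With the pairs fixed, the training
set is a vertex of a cube, only finitely many weight vectors occur, and the `2N` points have
features in a Euclidean space. The claim becomes a statement about random signs, `cubeProb_gap_le`.

The difficulty there is that the norm of the learned vector is unknown beforehand, and a union bound
over norm levels would cost a logarithm. Instead each vector is shrunk to a common radius and its
loss is multiplied by the same factor. The scaled loss is Lipschitz in the scaled prediction and in
the factor, so a two-parameter contraction principle (`contraction`) reduces it to Rademacher sums;
bounded differences give the tail. The radius is set by truncating the feature norms, so that a
random half of the pairs carries enough of the kernel trace to undo the shrinking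
(`cubeProb_sum_le`). -/

namespace QKernel

/-! ### Averages and bounded differences on the discrete cube. -/

/-- The average of a function over the discrete cube. -/
noncomputable def cubeAvg (n : ℕ) (f : (Fin n → Bool) → ℝ) : ℝ := (∑ σ, f σ) / 2 ^ n

/-- The sign encoded by a Boolean. -/
def sgn (b : Bool) : ℝ := if b then 1 else -1

@[simp] lemma sgn_true : sgn true = 1 := rfl

@[simp] lemma sgn_false : sgn false = -1 := rfl

lemma cubeAvg_zero (f : (Fin 0 → Bool) → ℝ) : cubeAvg 0 f = f Fin.elim0 := by
  simp only [cubeAvg, Finset.univ_unique, Finset.sum_singleton, pow_zero, div_one]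
  congr 1

lemma cubeAvg_add {n : ℕ} (f g : (Fin n → Bool) → ℝ) :
    cubeAvg n (fun σ => f σ + g σ) = cubeAvg n f + cubeAvg n g := by
  simp only [cubeAvg, Finset.sum_add_distrib, add_div]

lemma cubeAvg_const_mul {n : ℕ} (c : ℝ) (f : (Fin n → Bool) → ℝ) :
    cubeAvg n (fun σ => c * f σ) = c * cubeAvg n f := by
  simp only [cubeAvg, ← Finset.mul_sum, mul_div_assoc]

lemma cubeAvg_const {n : ℕ} (c : ℝ) : cubeAvg n (fun _ => c) = c := by
  simp [cubeAvg]

lemma cubeAvg_mono {n : ℕ} {f g : (Fin n → Bool) → ℝ} (h : ∀ σ, f σ ≤ g σ) :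
    cubeAvg n f ≤ cubeAvg n g := by
  unfold cubeAvg
  gcongr with σ
  exact h σ

lemma cubeAvg_nonneg {n : ℕ} {f : (Fin n → Bool) → ℝ} (h : ∀ σ, 0 ≤ f σ) : 0 ≤ cubeAvg n f :=
  div_nonneg (Finset.sum_nonneg fun σ _ => h σ) (by positivity)

lemma cubeAvg_succ {n : ℕ} (f : (Fin (n + 1) → Bool) → ℝ) :
    cubeAvg (n + 1) f =
      cubeAvg n (fun τ => (f (Fin.cons true τ) + f (Fin.cons false τ)) / 2) := by
  have h : ∑ σ, f σ = ∑ τ, (f (Fin.cons true τ) + f (Fin.cons false τ)) := by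
    rw [← (Fin.consEquiv fun _ => Bool).sum_comp, Fintype.sum_prod_type, Fintype.sum_bool,
      Finset.sum_add_distrib]
    rfl
  simp only [cubeAvg, h, ← Finset.sum_div, pow_succ]
  field_simp

lemma cubeAvg_succ' {n : ℕ} (f : (Fin (n + 1) → Bool) → ℝ) :
    cubeAvg (n + 1) f =
      (cubeAvg n (fun τ => f (Fin.cons true τ)) + cubeAvg n (fun τ => f (Fin.cons false τ))) / 2 := by
  rw [cubeAvg_succ, ← cubeAvg_add]
  simp only [div_eq_inv_mul, cubeAvg_const_mul]

lemma sq_cubeAvg_le {n : ℕ} (f : (Fin n → Bool) → ℝ) :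
    cubeAvg n f ^ 2 ≤ cubeAvg n (fun σ => f σ ^ 2) := by
  have h : 0 ≤ cubeAvg n (fun σ => (f σ - cubeAvg n f) ^ 2) :=
    cubeAvg_nonneg fun σ => sq_nonneg _
  have e : (fun σ => (f σ - cubeAvg n f) ^ 2) =
      fun σ => f σ ^ 2 + ((-2 * cubeAvg n f) * f σ + cubeAvg n f ^ 2) := by
    ext σ; ring
  rw [e, cubeAvg_add, cubeAvg_add, cubeAvg_const_mul, cubeAvg_const] at h
  nlinarith

lemma cubeAvg_comp_equiv {n : ℕ} (e : (Fin n → Bool) ≃ (Fin n → Bool)) (f : (Fin n → Bool) → ℝ) :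
    cubeAvg n (fun σ => f (e σ)) = cubeAvg n f := by
  simp only [cubeAvg, e.sum_comp f]

/-- Exponential moments of functions with bounded differences on the cube. -/
theorem cubeAvg_exp_le {n : ℕ} (f : (Fin n → Bool) → ℝ) {c : ℝ}
    (hf : ∀ σ i b, |f σ - f (Function.update σ i b)| ≤ c) (s : ℝ) :
    cubeAvg n (fun σ => Real.exp (s * (f σ - cubeAvg n f))) ≤
      Real.exp (s ^ 2 * (n * c ^ 2) / 8) := by
  induction n with
  | zero => simp [cubeAvg_zero]
  | succ n ih =>
    -- Averaging out the first sign keeps bounded differences, so the induction hypothesis applies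
    -- to `g`.
    set g : (Fin n → Bool) → ℝ := fun τ => (f (Fin.cons true τ) + f (Fin.cons false τ)) / 2
      with hg
    have hgf : cubeAvg (n + 1) f = cubeAvg n g := cubeAvg_succ f
    have hgd : ∀ τ i b, |g τ - g (Function.update τ i b)| ≤ c := by
      intro τ i b
      have h1 := hf (Fin.cons true τ) i.succ b
      have h0 := hf (Fin.cons false τ) i.succ b
      rw [← Fin.cons_update] at h1 h0
      rw [abs_le] at h1 h0 ⊢
      simp only [hg]
      constructor <;> linarith [h1.1, h1.2, h0.1, h0.2]
    have key : ∀ τ : Fin n → Bool,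
        (Real.exp (s * (f (Fin.cons true τ) - cubeAvg n g)) +
          Real.exp (s * (f (Fin.cons false τ) - cubeAvg n g))) / 2 ≤
        Real.exp (s ^ 2 * c ^ 2 / 8) * Real.exp (s * (g τ - cubeAvg n g)) := by
      intro τ
      set y := s * (f (Fin.cons true τ) - f (Fin.cons false τ)) / 2 with hy
      have e1 : s * (f (Fin.cons true τ) - cubeAvg n g) = s * (g τ - cubeAvg n g) + y := by
        simp only [hg, hy]; ring
      have e0 : s * (f (Fin.cons false τ) - cubeAvg n g) = s * (g τ - cubeAvg n g) + -y := by
        simp only [hg, hy]; ring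
      have hd := hf (Fin.cons true τ) 0 false
      rw [Fin.update_cons_zero] at hd
      -- The two values lie symmetrically at `±y` around their mean, with `|y| ≤ |s| c / 2`.
      have hc : Real.cosh y ≤ Real.exp (s ^ 2 * c ^ 2 / 8) := by
        refine (Real.cosh_le_exp_half_sq y).trans (Real.exp_le_exp.2 ?_)
        have : (f (Fin.cons true τ) - f (Fin.cons false τ)) ^ 2 ≤ c ^ 2 := by
          rw [← sq_abs]
          gcongr
        rw [hy]
        nlinarith [mul_le_mul_of_nonneg_left this (sq_nonneg s)]
      rw [e1, e0, Real.exp_add, Real.exp_add]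
      calc _ = Real.cosh y * Real.exp (s * (g τ - cubeAvg n g)) := by
            rw [Real.cosh_eq]; ring
        _ ≤ _ := by gcongr
    rw [hgf, cubeAvg_succ]
    refine (cubeAvg_mono key).trans ?_
    rw [cubeAvg_const_mul]
    calc _ ≤ Real.exp (s ^ 2 * c ^ 2 / 8) * Real.exp (s ^ 2 * (n * c ^ 2) / 8) := by
          gcongr
          exact ih g hgd
      _ = _ := by rw [← Real.exp_add]; push_cast; ring_nf

open Classical in
/-- The proportion of the vertices of the cube that satisfy `p`. -/
noncomputable def cubeProb (n : ℕ) (p : (Fin n → Bool) → Prop) : ℝ :=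
  cubeAvg n (fun σ => if p σ then 1 else 0)

lemma cubeProb_or_le {n : ℕ} {p q r : (Fin n → Bool) → Prop} (h : ∀ σ, p σ → q σ ∨ r σ) :
    cubeProb n p ≤ cubeProb n q + cubeProb n r := by
  classical
  unfold cubeProb
  rw [← cubeAvg_add]
  refine cubeAvg_mono fun σ => ?_
  have := h σ
  by_cases hp : p σ <;> by_cases hq : q σ <;> by_cases hr : r σ <;> simp_all

lemma cubeProb_le_cubeAvg {n : ℕ} {p : (Fin n → Bool) → Prop} {f : (Fin n → Bool) → ℝ}
    (h0 : ∀ σ, 0 ≤ f σ) (h1 : ∀ σ, p σ → 1 ≤ f σ) : cubeProb n p ≤ cubeAvg n f := by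
  classical
  refine cubeAvg_mono fun σ => ?_
  split_ifs with hp
  exacts [h1 σ hp, h0 σ]

/-- The bounded differences inequality on the cube. -/
theorem cubeProb_bounded_differences {n : ℕ} (hn : 0 < n) (f : (Fin n → Bool) → ℝ) {c : ℝ}
    (hc : 0 < c) (hf : ∀ σ i b, |f σ - f (Function.update σ i b)| ≤ c) {η : ℝ} (hη : 0 ≤ η) :
    cubeProb n (fun σ => cubeAvg n f + η ≤ f σ) ≤ Real.exp (-(2 * η ^ 2 / (n * c ^ 2))) := by
  have hn' : (0 : ℝ) < n := by exact_mod_cast hn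
  -- This `s` minimizes the Chernoff exponent `s ^ 2 * (n * c ^ 2) / 8 - s * η`.
  set s := 4 * η / (n * c ^ 2) with hs
  have h := cubeAvg_exp_le f hf s
  calc _ ≤ cubeAvg n (fun σ => Real.exp (-(s * η)) * Real.exp (s * (f σ - cubeAvg n f))) := by
        refine cubeProb_le_cubeAvg (fun σ => by positivity) fun σ hσ => ?_
        rw [← Real.exp_add]
        refine Real.one_le_exp ?_
        have : 0 ≤ s * (f σ - cubeAvg n f - η) :=
          mul_nonneg (by positivity) (by linarith)
        linarith
    _ ≤ Real.exp (-(s * η)) * Real.exp (s ^ 2 * (n * c ^ 2) / 8) := by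
        rw [cubeAvg_const_mul]; gcongr
    _ = _ := by
        rw [← Real.exp_add]
        congr 1
        rw [hs]
        field_simp
        ring

/-! ### Rademacher sums of vectors. -/

section Rademacher

variable {H : Type*} [NormedAddCommGroup H] [InnerProductSpace ℝ H]

/-- The parallelogram law removes one sign at a time; the offset `u` carries the signs already
fixed. -/
lemma cubeAvg_norm_sq {n : ℕ} (u : H) (φ : Fin n → H) :
    cubeAvg n (fun τ => ‖u + ∑ i, sgn (τ i) • φ i‖ ^ 2) = ‖u‖ ^ 2 + ∑ i, ‖φ i‖ ^ 2 := by
  induction n generalizing u with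
  | zero => simp [cubeAvg_zero]
  | succ n ih =>
    have h1 := ih (u + φ 0) (fun i => φ i.succ)
    have h0 := ih (u - φ 0) (fun i => φ i.succ)
    have hp := parallelogram_law_with_norm ℝ u (φ 0)
    rw [cubeAvg_succ']
    simp only [Fin.sum_univ_succ, Fin.cons_zero, Fin.cons_succ, sgn_true, sgn_false, one_smul,
      neg_smul, ← add_assoc, ← sub_eq_add_neg]
    rw [h1, h0]
    linarith

lemma cubeAvg_norm_le {n : ℕ} (φ : Fin n → H) :
    cubeAvg n (fun τ => ‖∑ i, sgn (τ i) • φ i‖) ≤ √(∑ i, ‖φ i‖ ^ 2) := by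
  apply Real.le_sqrt_of_sq_le
  refine (sq_cubeAvg_le _).trans (le_of_eq ?_)
  simpa using cubeAvg_norm_sq (0 : H) φ

end Rademacher

/-! ### Two-parameter contraction principle. -/

section Contraction

variable {A : Type*} [Finite A]

lemma le_iSup_finite (f : A → ℝ) (a : A) : f a ≤ ⨆ a, f a :=
  le_ciSup (Set.finite_range f).bddAbove a

variable [Nonempty A]

/-- Averaging `|2x + 4y|` and `|2x - 4y|` gives `max (2|x|) (4|y|)`, which is at least `|x| + 2|y|`.
A second independent sign thus dominates increments in both parameters, at the price of doubling the
coefficients. -/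
lemma contraction_step (F ψ v t : A → ℝ)
    (h : ∀ a b, |ψ a - ψ b| ≤ |v a - v b| + 2 * |t a - t b|) :
    ((⨆ a, (F a + ψ a)) + ⨆ a, (F a + -ψ a)) / 2 ≤
      (((⨆ a, (F a + (2 * v a + 4 * t a))) + ⨆ a, (F a + (2 * v a + -(4 * t a)))) / 2 +
        ((⨆ a, (F a + -(2 * v a + 4 * t a))) + ⨆ a, (F a + -(2 * v a + -(4 * t a)))) / 2) / 2 := by
  have hQ : ∀ (D : A → ℝ) (a b : A), F a + F b + |D a - D b| ≤
      (⨆ a, (F a + D a)) + ⨆ a, (F a + -D a) := by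
    intro D a b
    have h1 := le_iSup_finite (fun a => F a + D a) a
    have h2 := le_iSup_finite (fun a => F a + D a) b
    have h3 := le_iSup_finite (fun a => F a + -D a) a
    have h4 := le_iSup_finite (fun a => F a + -D a) b
    rcases abs_cases (D a - D b) with ⟨h, _⟩ | ⟨h, _⟩ <;> rw [h] <;> linarith
  suffices hs : ∀ a b, (F a + ψ a) + (F b + -ψ b) ≤
      (((⨆ a, (F a + (2 * v a + 4 * t a))) + ⨆ a, (F a + (2 * v a + -(4 * t a)))) +
        ((⨆ a, (F a + -(2 * v a + 4 * t a))) + ⨆ a, (F a + -(2 * v a + -(4 * t a))))) / 2 by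
    have : (⨆ a, (F a + ψ a)) + ⨆ a, (F a + -ψ a) ≤ _ :=
      ciSup_add_ciSup_le hs
    linarith
  intro a b
  have hp := hQ (fun a => 2 * v a + 4 * t a) a b
  have hm := hQ (fun a => 2 * v a + -(4 * t a)) a b
  have hab := h a b
  have habs : 2 * |v a - v b| + 4 * |t a - t b| ≤
      |2 * v a + 4 * t a - (2 * v b + 4 * t b)| +
        |2 * v a + -(4 * t a) - (2 * v b + -(4 * t b))| := by
    have e1 : 2 * v a + 4 * t a - (2 * v b + 4 * t b) = 2 * (v a - v b) + 4 * (t a - t b) := by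
      ring
    have e2 : 2 * v a + -(4 * t a) - (2 * v b + -(4 * t b)) =
        2 * (v a - v b) - 4 * (t a - t b) := by ring
    rw [e1, e2]
    generalize v a - v b = x
    generalize t a - t b = y
    rcases abs_cases x with ⟨h, _⟩ | ⟨h, _⟩ <;> rcases abs_cases y with ⟨h', _⟩ | ⟨h', _⟩ <;>
      rcases abs_cases (2 * x + 4 * y) with ⟨h1, _⟩ | ⟨h1, _⟩ <;>
      rcases abs_cases (2 * x - 4 * y) with ⟨h2, _⟩ | ⟨h2, _⟩ <;> rw [h, h', h1, h2] <;> linarith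
  have := le_abs_self (ψ a - ψ b)
  linarith

/-- A contraction principle for Rademacher averages of functions of two parameters. -/
theorem contraction {n : ℕ} (F t : A → ℝ) (ψ v : Fin n → A → ℝ)
    (h : ∀ i a b, |ψ i a - ψ i b| ≤ |v i a - v i b| + 2 * |t a - t b|) :
    cubeAvg n (fun τ => ⨆ a, (F a + ∑ i, sgn (τ i) * ψ i a)) ≤
      cubeAvg n (fun τ => cubeAvg n (fun τ' =>
        ⨆ a, (F a + ∑ i, sgn (τ i) * (2 * v i a + sgn (τ' i) * (4 * t a))))) := by
  induction n generalizing F with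
  | zero => simp [cubeAvg_zero]
  | succ n ih =>
    -- `F` absorbs the first coordinate, once for each of its four sign patterns.
    have IH := fun F => ih F (fun i => ψ i.succ) (fun i => v i.succ) (fun i => h i.succ)
    have h1 := IH (fun a => F a + (2 * v 0 a + 4 * t a))
    have h2 := IH (fun a => F a + (2 * v 0 a + -(4 * t a)))
    have h3 := IH (fun a => F a + -(2 * v 0 a + 4 * t a))
    have h4 := IH (fun a => F a + -(2 * v 0 a + -(4 * t a)))
    have hstep : ∀ τ : Fin n → Bool, _ := fun τ => contraction_step
      (fun a => F a + ∑ i, sgn (τ i) * ψ i.succ a) (ψ 0) (v 0) t (h 0)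
    have hL := cubeAvg_mono hstep
    rw [cubeAvg_succ, cubeAvg_succ']
    simp only [cubeAvg_succ', Fin.sum_univ_succ, Fin.cons_zero, Fin.cons_succ, sgn_true,
      sgn_false, one_mul, neg_mul]
    have e : ∀ (τ : Fin n → Bool) (G : A → ℝ), ⨆ a, (F a + ∑ i, sgn (τ i) * ψ i.succ a + G a) =
        ⨆ a, (F a + G a + ∑ i, sgn (τ i) * ψ i.succ a) :=
      fun τ G => iSup_congr fun a => add_right_comm _ _ _
    simp only [e] at hL
    simp only [div_eq_inv_mul, cubeAvg_const_mul, cubeAvg_add] at hL ⊢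
    simp only [← add_assoc] at hL h1 h2 h3 h4 ⊢
    linarith

end Contraction

/-! ### Lipschitz properties of scaled clipped losses. -/

/-- Clipping to the interval `[-1, 1]`. -/
noncomputable def clip (v : ℝ) : ℝ := min 1 (max (-1) v)

lemma clip_le_one (v : ℝ) : clip v ≤ 1 := min_le_left _ _

lemma neg_one_le_clip (v : ℝ) : -1 ≤ clip v := le_min (by norm_num) (le_max_left _ _)

lemma abs_clip_sub_le_two (v : ℝ) {y : ℝ} (hy : |y| ≤ 1) : |clip v - y| ≤ 2 := by
  have := clip_le_one v
  have := neg_one_le_clip v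
  rw [abs_le] at hy ⊢
  constructor <;> linarith [hy.1, hy.2]

lemma mul_clip {t : ℝ} (ht : 0 ≤ t) (v : ℝ) : t * clip v = min t (max (-t) (t * v)) := by
  rw [clip, mul_min_of_nonneg _ _ ht, mul_max_of_nonneg _ _ ht]
  simp

/-- `t * clip v` truncates `t * v` to `[-t, t]`, so `t` enters separately only through the
endpoints. Hence the two parameters `t * v` and `t` in `contraction`. -/
lemma abs_mul_clip_sub_le {t t' : ℝ} (ht : 0 ≤ t) (ht' : 0 ≤ t') (v v' : ℝ) :
    |t * clip v - t' * clip v'| ≤ |t * v - t' * v'| + |t - t'| := by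
  rw [mul_clip ht, mul_clip ht']
  refine (abs_min_sub_min_le_max _ _ _ _).trans (max_le ?_ ?_)
  · linarith [abs_nonneg (t * v - t' * v')]
  · refine (abs_max_sub_max_le_max _ _ _ _).trans (max_le ?_ ?_)
    · rw [neg_sub_neg, abs_sub_comm]
      linarith [abs_nonneg (t * v - t' * v')]
    · linarith [abs_nonneg (t - t')]

lemma abs_mul_abs_clip_sub_le {t t' y : ℝ} (ht : 0 ≤ t) (ht' : 0 ≤ t') (hy : |y| ≤ 1)
    (v v' : ℝ) :
    |t * abs (clip v - y) - t' * abs (clip v' - y)| ≤ |t * v - t' * v'| + 2 * |t - t'| := by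
  have e : ∀ {s : ℝ} (_ : 0 ≤ s) (x : ℝ), s * |x| = |s * x| := fun hs x => by
    rw [abs_mul, abs_of_nonneg hs]
  rw [e ht, e ht']
  refine (abs_abs_sub_abs_le_abs_sub _ _).trans ?_
  have : t * (clip v - y) - t' * (clip v' - y) =
      (t * clip v - t' * clip v') - (t - t') * y := by ring
  rw [this]
  refine (abs_sub _ _).trans ?_
  have h1 := abs_mul_clip_sub_le ht ht' v v'
  have h2 : |(t - t') * y| ≤ |t - t'| := by
    rw [abs_mul]
    exact mul_le_of_le_one_right (abs_nonneg _) hy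
  linarith

lemma abs_clip_sub_le (v : ℝ) {y : ℝ} (hy : |y| ≤ 1) : |clip v - y| ≤ |v - y| := by
  have e : clip y = y := by
    rw [abs_le] at hy
    rw [clip, max_eq_right hy.1, min_eq_right hy.2]
  have := abs_mul_clip_sub_le zero_le_one zero_le_one v y
  simpa [e] using this

/-! ### Rademacher averages of clipped losses. -/

section Hilbert

variable {H : Type*} [NormedAddCommGroup H] [InnerProductSpace ℝ H]

/-- Rademacher averages of scaled losses of clipped linear functions. -/
lemma cubeAvg_iSup_loss_le {A : Type*} [Finite A] [Nonempty A] {n : ℕ} (S : Finset (Fin n))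
    (t : A → ℝ) (ht0 : ∀ a, 0 ≤ t a) (ht1 : ∀ a, t a ≤ 1) (w : A → H) {r : ℝ}
    (hr : ∀ a, ‖t a • w a‖ ≤ r) (φ : Fin n → H) (y : Fin n → ℝ) (hy : ∀ i, |y i| ≤ 1) :
    cubeAvg n (fun τ => ⨆ a, ∑ i, sgn (τ i) *
        (if i ∈ S then t a * abs (clip (inner ℝ (w a) (φ i)) - y i) else 0)) ≤
      2 * (r * √(∑ i ∈ S, ‖φ i‖ ^ 2)) + 4 * √n := by
  have hr0 : 0 ≤ r := (norm_nonneg _).trans (hr (Classical.arbitrary A))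
  set φ' : Fin n → H := fun i => if i ∈ S then φ i else 0 with hφ'
  have hc := contraction (n := n) (fun _ : A => 0) t
    (fun i a => if i ∈ S then t a * abs (clip (inner ℝ (w a) (φ i)) - y i) else 0)
    (fun i a => inner ℝ (t a • w a) (φ' i)) (by
      intro i a b
      simp only [hφ']
      split_ifs
      · simp only [real_inner_smul_left]
        exact abs_mul_abs_clip_sub_le (ht0 a) (ht0 b) (hy i) _ _
      · simp)
  simp only [zero_add] at hc
  refine hc.trans ?_
  -- After contraction everything is linear in `t a • w a` and `t a`, whose sizes are at most `r`
  -- and `1`; the supremum is gone.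
  have hpt : ∀ τ τ' : Fin n → Bool,
      (⨆ a, ∑ i, sgn (τ i) * (2 * inner ℝ (t a • w a) (φ' i) + sgn (τ' i) * (4 * t a))) ≤
        2 * r * ‖∑ i, sgn (τ i) • φ' i‖ + 4 * ‖∑ i, sgn (τ i) • sgn (τ' i)‖ := by
    intro τ τ'
    refine ciSup_le fun a => ?_
    have e : ∑ i, sgn (τ i) * (2 * inner ℝ (t a • w a) (φ' i) + sgn (τ' i) * (4 * t a)) =
        2 * inner ℝ (t a • w a) (∑ i, sgn (τ i) • φ' i) +
          4 * (t a * ∑ i, sgn (τ i) • sgn (τ' i)) := by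
      simp only [inner_sum, real_inner_smul_right, Finset.mul_sum, smul_eq_mul,
        ← Finset.sum_add_distrib]
      exact Finset.sum_congr rfl fun i _ => by ring
    rw [e]
    have h1 : inner ℝ (t a • w a) (∑ i, sgn (τ i) • φ' i) ≤ r * ‖∑ i, sgn (τ i) • φ' i‖ :=
      (real_inner_le_norm _ _).trans (by gcongr; exact hr a)
    have h2 : t a * ∑ i, sgn (τ i) • sgn (τ' i) ≤ ‖∑ i, sgn (τ i) • sgn (τ' i)‖ := by
      refine (mul_le_mul_of_nonneg_left (Real.le_norm_self _) (ht0 a)).trans ?_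
      exact mul_le_of_le_one_left (norm_nonneg _) (ht1 a)
    linarith
  refine (cubeAvg_mono fun τ => cubeAvg_mono (hpt τ)).trans ?_
  simp only [cubeAvg_add, cubeAvg_const_mul, cubeAvg_const]
  have h1 := cubeAvg_norm_le φ'
  have e1 : ∑ i, ‖φ' i‖ ^ 2 = ∑ i ∈ S, ‖φ i‖ ^ 2 := by
    rw [← Finset.sum_filter_add_sum_filter_not Finset.univ (· ∈ S)]
    rw [Finset.sum_eq_zero (s := Finset.univ.filter (· ∉ S)), add_zero]
    · refine Finset.sum_congr (by simp) fun i hi => by simp [hφ', hi]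
    · intro i hi
      simp only [Finset.mem_filter, Finset.mem_univ, true_and] at hi
      simp [hφ', hi]
  rw [e1] at h1
  have h2 : cubeAvg n (fun τ => cubeAvg n (fun τ' => ‖∑ i, sgn (τ i) • sgn (τ' i)‖)) ≤ √n := by
    have : ∀ τ : Fin n → Bool, cubeAvg n (fun τ' => ‖∑ i, sgn (τ i) • sgn (τ' i)‖) ≤ √n := by
      intro τ
      have h := cubeAvg_norm_le (fun i => sgn (τ i))
      have e2 : ∑ i : Fin n, ‖sgn (τ i)‖ ^ 2 = n := by
        rw [Finset.sum_congr rfl (g := fun _ => (1 : ℝ))]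
        · simp
        · intro i _
          cases τ i <;> simp
      rw [e2] at h
      simpa only [smul_eq_mul, mul_comm] using h
    simpa [cubeAvg_const] using cubeAvg_mono this
  nlinarith [mul_le_mul_of_nonneg_left h1 hr0]

end Hilbert

/-! ### Random selections from pairs and the truncation scale. -/

/-- The lower tail of a random selection of one element from each of `n` pairs. -/
lemma cubeProb_sum_le {n : ℕ} (v : Fin n → Bool → ℝ) (h0 : ∀ i b, 0 ≤ v i b)
    (h1 : ∀ i b, v i b ≤ 1) {L : ℝ} (hL : ∑ i, max (v i true) (v i false) = 8 * L) :
    cubeProb n (fun σ => ∑ i, v i (σ i) ≤ L) ≤ Real.exp (-L) := by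
  have mgf : ∀ {n : ℕ} (v : Fin n → Bool → ℝ) (_ : ∀ i b, 0 ≤ v i b) (_ : ∀ i b, v i b ≤ 1),
      cubeAvg n (fun σ => Real.exp (-∑ i, v i (σ i))) ≤
        Real.exp (-(∑ i, max (v i true) (v i false)) / 4) := by
    intro n
    induction n with
    | zero => intro v _ _; simp [cubeAvg_zero]
    | succ n ih =>
      intro v h0 h1
      -- With `M` the larger value and the other one nonnegative, the average is at most `(exp (-M)
      -- + 1) / 2 ≤ 1 - M / 4 ≤ exp (-M / 4)`.
      have two : (Real.exp (-v 0 true) + Real.exp (-v 0 false)) / 2 ≤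
          Real.exp (-max (v 0 true) (v 0 false) / 4) := by
        have one : ∀ u : ℝ, 0 ≤ u → u ≤ 1 → Real.exp (-u) ≤ 1 - u / 2 := by
          intro u hu0 hu1
          rw [Real.exp_neg, inv_le_iff_one_le_mul₀ (Real.exp_pos u)]
          nlinarith [mul_le_mul_of_nonneg_left (Real.add_one_le_exp u)
            (by linarith : 0 ≤ 1 - u / 2)]
        have e0 := fun b => Real.exp_le_one_iff.2 (neg_nonpos.2 (h0 0 b))
        rcases max_cases (v 0 true) (v 0 false) with ⟨h, _⟩ | ⟨h, _⟩ <;> rw [h]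
        · linarith [one _ (h0 0 true) (h1 0 true), e0 false,
            Real.add_one_le_exp (-v 0 true / 4)]
        · linarith [one _ (h0 0 false) (h1 0 false), e0 true,
            Real.add_one_le_exp (-v 0 false / 4)]
      have IH := ih (fun i => v i.succ) (fun i => h0 i.succ) (fun i => h1 i.succ)
      rw [cubeAvg_succ]
      simp only [Fin.sum_univ_succ, Fin.cons_zero, Fin.cons_succ, neg_add, Real.exp_add,
        ← add_mul, mul_div_right_comm, add_div]
      rw [cubeAvg_const_mul]
      rw [← add_div]
      exact mul_le_mul two IH (cubeAvg_nonneg fun σ => (Real.exp_pos _).le) (Real.exp_pos _).le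
  calc _ ≤ cubeAvg n (fun σ => Real.exp L * Real.exp (-∑ i, v i (σ i))) := by
        refine cubeProb_le_cubeAvg (fun σ => by positivity) fun σ hσ => ?_
        rw [← Real.exp_add]
        exact Real.one_le_exp (by linarith)
    _ ≤ Real.exp L * Real.exp (-(8 * L) / 4) := by
        rw [cubeAvg_const_mul, ← hL]
        gcongr
        exact mgf v h0 h1
    _ = _ := by rw [← Real.exp_add]; congr 1; ring

/-- The truncated sum is continuous in `s` and vanishes at `0`. If it has not passed `K` at `max B
1`, that large value serves as `s`. -/
lemma exists_scale {n : ℕ} (m : Fin n → ℝ) {K : ℝ} (hK : 0 < K) (B : ℝ) :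
    ∃ s : ℝ, 0 < s ∧ ∑ i, min (s * m i) 1 ≤ K ∧ (∑ i, min (s * m i) 1 = K ∨ B ≤ s) := by
  set f : ℝ → ℝ := fun s => ∑ i, min (s * m i) 1 with hf
  set b := max B 1
  have hb : 0 < b := lt_max_of_lt_right one_pos
  rcases le_or_gt (f b) K with h | h
  · exact ⟨b, hb, h, Or.inr (le_max_left _ _)⟩
  · have hcont : ContinuousOn f (Set.Icc 0 b) := by
      apply Continuous.continuousOn
      fun_prop
    have h0 : f 0 = 0 := by simp [hf]
    obtain ⟨s, hs, hfs⟩ := intermediate_value_Icc hb.le hcont ⟨h0.le.trans hK.le, h.le⟩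
    refine ⟨s, lt_of_le_of_ne hs.1 fun h => ?_, hfs.le, Or.inl hfs⟩
    rw [← h, h0] at hfs
    exact hK.ne hfs

lemma sgn_not (b : Bool) : sgn (!b) = -sgn b := by cases b <;> simp

lemma abs_sgn_mul (b : Bool) (x : ℝ) : |sgn b * x| = |x| := by cases b <;> simp

/-- A supremum of Rademacher sums has bounded differences. -/
lemma abs_iSup_sub_update_le {A : Type*} [Finite A] [Nonempty A] {n : ℕ} (x : A → Fin n → ℝ)
    {c : ℝ} (hx : ∀ a i, |x a i| ≤ c) (σ : Fin n → Bool) (i : Fin n) (b : Bool) :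
    |(⨆ a, ∑ j, sgn (σ j) * x a j) - ⨆ a, ∑ j, sgn (Function.update σ i b j) * x a j| ≤
      2 * c := by
  have h : ∀ a, |(∑ j, sgn (σ j) * x a j) - ∑ j, sgn (Function.update σ i b j) * x a j| ≤
      2 * c := by
    intro a
    rw [← Finset.sum_sub_distrib, Finset.sum_eq_single i]
    · refine (abs_sub _ _).trans ?_
      rw [abs_sgn_mul, abs_sgn_mul]
      linarith [hx a i]
    · intro j _ hj
      rw [Function.update_of_ne hj, sub_self]
    · simp
  rw [abs_le]
  constructor
  · have : (⨆ a, ∑ j, sgn (Function.update σ i b j) * x a j) ≤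
        (⨆ a, ∑ j, sgn (σ j) * x a j) + 2 * c :=
      ciSup_le fun a => by
        linarith [(abs_le.1 (h a)).1, le_iSup_finite (fun a => ∑ j, sgn (σ j) * x a j) a]
    linarith
  · have : (⨆ a, ∑ j, sgn (σ j) * x a j) ≤
        (⨆ a, ∑ j, sgn (Function.update σ i b j) * x a j) + 2 * c :=
      ciSup_le fun a => by
        linarith [(abs_le.1 (h a)).2,
          le_iSup_finite (fun a => ∑ j, sgn (Function.update σ i b j) * x a j) a]
    linarith

/-! ### The gap between the two halves of a paired sample. -/

section Hilbert

variable {H : Type*} [NormedAddCommGroup H] [InnerProductSpace ℝ H]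

/-- The expected maximal scaled difference between the losses on two halves of a paired sample. -/
lemma cubeAvg_iSup_gap_le {A : Type*} [Finite A] [Nonempty A] {n : ℕ} (S : Finset (Fin n))
    (t : A → ℝ) (ht0 : ∀ a, 0 ≤ t a) (ht1 : ∀ a, t a ≤ 1) (w : A → H) {r : ℝ}
    (hr : ∀ a, ‖t a • w a‖ ≤ r) (φ : Fin n → Bool → H) (y : Fin n → Bool → ℝ)
    (hy : ∀ i b, |y i b| ≤ 1) {R : ℝ} (hR : ∀ b, r * √(∑ i ∈ S, ‖φ i b‖ ^ 2) ≤ R) :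
    cubeAvg n (fun σ => ⨆ a, ∑ i, sgn (σ i) *
        (t a * (|clip (inner ℝ (w a) (φ i false)) - y i false| -
          |clip (inner ℝ (w a) (φ i true)) - y i true|))) ≤
      4 * R + 8 * √n + 2 * (Sᶜ.card : ℝ) := by
  set l : A → Fin n → Bool → ℝ := fun a i b => |clip (inner ℝ (w a) (φ i b)) - y i b| with hl
  have hl0 : ∀ a i b, 0 ≤ l a i b := fun a i b => abs_nonneg _
  have hl2 : ∀ a i b, l a i b ≤ 2 := fun a i b => abs_clip_sub_le_two _ (hy i b)
  set G : Bool → (Fin n → Bool) → ℝ := fun b τ =>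
    ⨆ a, ∑ i, sgn (τ i) * (if i ∈ S then t a * l a i b else 0) with hG
  have hGle : ∀ b, cubeAvg n (G b) ≤ 2 * R + 4 * √n := fun b =>
    (cubeAvg_iSup_loss_le S t ht0 ht1 w hr (fun i => φ i b) (fun i => y i b)
      fun i => hy i b).trans (by linarith [hR b])
  -- The two losses enter with opposite signs; flipping the whole cube makes both ordinary
  -- Rademacher averages.
  have hflip : cubeAvg n (fun σ => G true (fun i => !σ i)) = cubeAvg n (G true) :=
    cubeAvg_comp_equiv (Equiv.arrowCongr (Equiv.refl _) Equiv.boolNot) (G true)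
  have hpt : ∀ σ : Fin n → Bool,
      (⨆ a, ∑ i, sgn (σ i) * (t a * (l a i false - l a i true))) ≤
        G false σ + G true (fun i => !σ i) + 2 * (Sᶜ.card : ℝ) := by
    intro σ
    refine ciSup_le fun a => ?_
    have h1 := le_iSup_finite
      (fun a => ∑ i, sgn (σ i) * (if i ∈ S then t a * l a i false else 0)) a
    have h2 := le_iSup_finite
      (fun a => ∑ i, sgn (!σ i) * (if i ∈ S then t a * l a i true else 0)) a
    have h3 : ∑ i, sgn (σ i) * (t a * (l a i false - l a i true)) ≤
        (∑ i, sgn (σ i) * (if i ∈ S then t a * l a i false else 0)) +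
        (∑ i, sgn (!σ i) * (if i ∈ S then t a * l a i true else 0)) +
        ∑ i, (if i ∈ Sᶜ then (2 : ℝ) else 0) := by
      rw [← Finset.sum_add_distrib, ← Finset.sum_add_distrib]
      refine Finset.sum_le_sum fun i _ => ?_
      rw [sgn_not]
      by_cases hi : i ∈ S
      · simp only [hi, if_true, Finset.mem_compl, not_true, if_false]
        linarith
      · simp only [hi, if_false, Finset.mem_compl, not_false_eq_true, if_true]
        have : |sgn (σ i) * (t a * (l a i false - l a i true))| ≤ 2 := by
          rw [abs_sgn_mul, abs_mul, abs_of_nonneg (ht0 a)]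
          have : |l a i false - l a i true| ≤ 2 := by
            rw [abs_le]
            constructor <;> linarith [hl0 a i false, hl0 a i true, hl2 a i false, hl2 a i true]
          nlinarith [ht0 a, ht1 a, abs_nonneg (l a i false - l a i true)]
        linarith [le_abs_self (sgn (σ i) * (t a * (l a i false - l a i true)))]
    have h4 : ∑ i, (if i ∈ Sᶜ then (2 : ℝ) else 0) = 2 * (Sᶜ.card : ℝ) := by
      rw [Finset.sum_ite_mem, Finset.univ_inter, Finset.sum_const, nsmul_eq_mul, mul_comm]
    simp only [hG]
    linarith
  refine (cubeAvg_mono hpt).trans ?_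
  rw [cubeAvg_add, cubeAvg_add, cubeAvg_const, hflip]
  linarith [hGle true, hGle false]

/-- Consider `n` pairs of labelled feature vectors. For most ways to choose a training sample
containing one element from each pair, a vector chosen in dependence of the sample has about the
same clipped absolute loss on the sample as on the remaining elements. -/
theorem cubeProb_gap_le {n : ℕ} (φ : Fin n → Bool → H) (y : Fin n → Bool → ℝ)
    (hy : ∀ i b, |y i b| ≤ 1) (w : (Fin n → Bool) → H) {L : ℝ} (hL : 1 ≤ L) (hLn : L ≤ n) :
    cubeProb n (fun σ => 40 * (‖w σ‖ * √(∑ i, ‖φ i (σ i)‖ ^ 2) + √(n * L)) <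
        ∑ i, (|clip (inner ℝ (w σ) (φ i (!σ i))) - y i (!σ i)| -
          |clip (inner ℝ (w σ) (φ i (σ i))) - y i (σ i)|)) ≤ 2 * Real.exp (-L) := by
  have hn1 : (1 : ℝ) ≤ n := hL.trans hLn
  have hn0 : (0 : ℝ) < n := by linarith
  have hn : 0 < n := by exact_mod_cast hn0
  have hL0 : 0 < L := by linarith
  set m : Fin n → ℝ := fun i => max (‖φ i true‖ ^ 2) (‖φ i false‖ ^ 2) with hm
  have hm0 : ∀ i, 0 ≤ m i := fun i => le_max_of_le_left (sq_nonneg _)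
  have hφm : ∀ i b, ‖φ i b‖ ^ 2 ≤ m i := by
    intro i b
    cases b
    exacts [le_max_right _ _, le_max_left _ _]
  -- The scale does not depend on `σ`. The target `8 * L` fits `cubeProb_sum_le`; if it is not
  -- attained, `s` exceeds every `‖w σ‖ ^ 2`, so no vector is longer than `r`.
  obtain ⟨s, hs, hsK, hs'⟩ := exists_scale m (by positivity : 0 < 8 * L) (⨆ σ, ‖w σ‖ ^ 2)
  set r := √(n * s) with hr
  have hr0 : 0 < r := Real.sqrt_pos.2 (by positivity)
  -- The factor shrinks exactly the vectors longer than `r`.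
  set t : (Fin n → Bool) → ℝ := fun a => r / max r ‖w a‖ with ht
  have htpos : ∀ a, 0 < t a := fun a => div_pos hr0 (lt_max_of_lt_left hr0)
  have ht1 : ∀ a, t a ≤ 1 := fun a => div_le_one_of_le₀ (le_max_left _ _) (by positivity)
  have htw : ∀ a, ‖t a • w a‖ ≤ r := by
    intro a
    rw [norm_smul, Real.norm_of_nonneg (htpos a).le, ht]
    simp only
    rw [div_mul_eq_mul_div, div_le_iff₀ (lt_max_of_lt_left hr0)]
    gcongr
    exact le_max_right _ _
  -- Each index outside `S` contributes `1` to the truncated sum, so there are at most `8 * L` of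
  -- them.
  set S : Finset (Fin n) := Finset.univ.filter fun i => s * m i < 1 with hS
  have hsplit := Finset.sum_filter_add_sum_filter_not Finset.univ (fun i => s * m i < 1)
    (fun i => min (s * m i) 1)
  have hS1 : ∑ i ∈ S, min (s * m i) 1 = s * ∑ i ∈ S, m i := by
    rw [Finset.mul_sum]
    refine Finset.sum_congr rfl fun i hi => min_eq_left ?_
    exact (Finset.mem_filter.1 hi).2.le
  have hS2 : ∑ i ∈ Finset.univ.filter (fun i => ¬ s * m i < 1), min (s * m i) 1 =
      (Sᶜ.card : ℝ) := by
    rw [hS, Finset.compl_filter, Finset.card_eq_sum_ones, Nat.cast_sum]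
    refine Finset.sum_congr rfl fun i hi => ?_
    rw [Nat.cast_one]
    exact min_eq_right (not_lt.1 (Finset.mem_filter.1 hi).2)
  rw [hS1, hS2] at hsplit
  have hSm : s * ∑ i ∈ S, m i ≤ 8 * L := by
    linarith [Nat.cast_nonneg (α := ℝ) Sᶜ.card]
  have hSc : (Sᶜ.card : ℝ) ≤ 8 * L := by
    linarith [mul_nonneg hs.le (Finset.sum_nonneg fun i (_ : i ∈ S) => hm0 i)]
  set R := √(n * L) with hRdef
  have hR0 : 0 ≤ R := Real.sqrt_nonneg _
  have h8 : √(8 : ℝ) ≤ 3 := by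
    rw [Real.sqrt_le_left (by norm_num)]; norm_num
  have hLR : L ≤ R := Real.le_sqrt_of_sq_le (by nlinarith)
  have hnR : √(n : ℝ) ≤ R := Real.sqrt_le_sqrt (by nlinarith)
  have h8R : √(n * (8 * L)) ≤ 3 * R := by
    have : (n : ℝ) * (8 * L) = 8 * (n * L) := by ring
    rw [this, Real.sqrt_mul (by norm_num)]
    gcongr
  have hrS : ∀ b, r * √(∑ i ∈ S, ‖φ i b‖ ^ 2) ≤ 3 * R := by
    intro b
    refine le_trans ?_ h8R
    rw [hr, ← Real.sqrt_mul (by positivity)]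
    apply Real.sqrt_le_sqrt
    rw [mul_assoc]
    refine mul_le_mul_of_nonneg_left (le_trans ?_ hSm) hn0.le
    gcongr with i _
    exact hφm i b
  set x : (Fin n → Bool) → Fin n → ℝ := fun a i =>
    t a * (|clip (inner ℝ (w a) (φ i false)) - y i false| -
          |clip (inner ℝ (w a) (φ i true)) - y i true|) with hx
  have hx2 : ∀ a i, |x a i| ≤ 2 := by
    intro a i
    simp only [hx]
    rw [abs_mul, abs_of_pos (htpos a)]
    refine (mul_le_of_le_one_left (abs_nonneg _) (ht1 a)).trans ?_
    have h1 := abs_clip_sub_le_two (inner ℝ (w a) (φ i false)) (hy i false)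
    have h2 := abs_clip_sub_le_two (inner ℝ (w a) (φ i true)) (hy i true)
    have h3 := abs_nonneg (clip (inner ℝ (w a) (φ i false)) - y i false)
    have h4 := abs_nonneg (clip (inner ℝ (w a) (φ i true)) - y i true)
    rw [abs_le]
    constructor <;> linarith
  set D : (Fin n → Bool) → ℝ := fun σ => ⨆ a, ∑ i, sgn (σ i) * x a i with hD
  -- `36 = 4 * 3 + 8 + 2 * 8`, from the terms in `3 * R`, `√n` and the size of `Sᶜ`.
  have hDavg : cubeAvg n D ≤ 36 * R := by
    have := cubeAvg_iSup_gap_le S t (fun a => (htpos a).le) ht1 w htw φ y hy hrS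
    simp only [hD, hx]
    linarith
  -- One sign moves `D` by at most `4`, so the exponent is `2 * (8 * n * L) / (16 * n) = L`. The
  -- deviation is at most `3 * R`, whence `39 * R` below.
  have htail : cubeProb n (fun σ => cubeAvg n D + √(n * (8 * L)) ≤ D σ) ≤ Real.exp (-L) := by
    refine (cubeProb_bounded_differences hn D (by norm_num : (0 : ℝ) < 2 * 2)
      (fun σ i b => abs_iSup_sub_update_le x hx2 σ i b) (Real.sqrt_nonneg _)).trans (le_of_eq ?_)
    rw [Real.sq_sqrt (by positivity)]
    congr 1
    field_simp
    norm_num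
  have hgap : ∀ σ, D σ < 39 * R →
      t σ * ∑ i, (|clip (inner ℝ (w σ) (φ i (!σ i))) - y i (!σ i)| -
          |clip (inner ℝ (w σ) (φ i (σ i))) - y i (σ i)|) < 39 * R := by
    intro σ hσ
    refine lt_of_le_of_lt ?_ hσ
    -- The supremum runs over all training choices, so it includes the vector learned from `σ`
    -- itself.
    refine le_trans (le_of_eq ?_) (le_iSup_finite (fun a => ∑ i, sgn (σ i) * x a i) σ)
    rw [Finset.mul_sum]
    refine Finset.sum_congr rfl fun i _ => ?_
    simp only [hx]
    cases σ i <;> simp only [Bool.not_true, Bool.not_false, sgn_true, sgn_false] <;> ring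
  have hcase : ∀ σ, ‖w σ‖ ≤ r ∨ ∑ i, min (s * m i) 1 = 8 * L := by
    intro σ
    rcases hs' with h | h
    · exact Or.inr h
    · refine Or.inl (Real.le_sqrt_of_sq_le ?_)
      nlinarith [le_iSup_finite (fun σ => ‖w σ‖ ^ 2) σ]
  have hfinal : ∀ σ, D σ < 39 * R → (‖w σ‖ ≤ r ∨ L < s * ∑ i, ‖φ i (σ i)‖ ^ 2) →
      ∑ i, (|clip (inner ℝ (w σ) (φ i (!σ i))) - y i (!σ i)| -
          |clip (inner ℝ (w σ) (φ i (σ i))) - y i (σ i)|) ≤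
        40 * (‖w σ‖ * √(∑ i, ‖φ i (σ i)‖ ^ 2) + R) := by
    intro σ hσ hor
    have hg := hgap σ hσ
    set g := ∑ i, (|clip (inner ℝ (w σ) (φ i (!σ i))) - y i (!σ i)| -
          |clip (inner ℝ (w σ) (φ i (σ i))) - y i (σ i)|)
    set T := ∑ i, ‖φ i (σ i)‖ ^ 2
    have hwT : 0 ≤ ‖w σ‖ * √T := by positivity
    rcases le_or_gt ‖w σ‖ r with hw | hw
    · have : t σ = 1 := by
        simp only [ht]
        rw [max_eq_left hw, div_self hr0.ne']
      rw [this, one_mul] at hg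
      linarith
    · have hLT : L < s * T := hor.resolve_left (not_le.2 hw)
      have hw0 : 0 < ‖w σ‖ := hr0.trans hw
      have : t σ = r / ‖w σ‖ := by
        simp only [ht]
        rw [max_eq_right hw.le]
      rw [this, div_mul_eq_mul_div, div_lt_iff₀ hw0] at hg
      -- Undoing the shrinking multiplies `39 * R` by `‖w σ‖ / r`; this inequality turns the result
      -- into `39 * ‖w σ‖ * √T`.
      have hRr : R ≤ r * √T := by
        rw [hr, ← Real.sqrt_mul (by positivity), mul_assoc]
        apply Real.sqrt_le_sqrt
        gcongr
      have : r * g ≤ r * (39 * (‖w σ‖ * √T)) := by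
        nlinarith [mul_le_mul_of_nonneg_left hRr hw0.le]
      have := le_of_mul_le_mul_left this hr0
      linarith
  rcases em (∑ i, min (s * m i) 1 = 8 * L) with h8L | h8L
  · have hlow := cubeProb_sum_le (fun i b => min (s * ‖φ i b‖ ^ 2) 1)
      (fun i b => le_min (by positivity) zero_le_one) (fun i b => min_le_right _ _) (L := L) (by
        rw [← h8L]
        refine Finset.sum_congr rfl fun i _ => ?_
        rw [← min_max_distrib_right, ← mul_max_of_nonneg _ _ hs.le])
    rw [two_mul]
    refine (cubeProb_or_le fun σ hσ => ?_).trans (add_le_add htail hlow)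
    by_contra! hcon
    refine absurd hσ (not_lt.2 (hfinal σ (by linarith [hcon.1]) (Or.inr ?_)))
    refine hcon.2.trans_le ?_
    rw [Finset.mul_sum]
    exact Finset.sum_le_sum fun i _ => min_le_left _ _
  · have : cubeProb n (fun _ => False) = 0 := by simp [cubeProb, cubeAvg_const]
    refine (cubeProb_or_le (q := fun σ => cubeAvg n D + √(n * (8 * L)) ≤ D σ)
      (r := fun _ => False) fun σ hσ => ?_).trans ?_
    · by_contra! hcon
      exact absurd hσ (not_lt.2 (hfinal σ (by linarith [hcon.1])
        (Or.inl ((hcase σ).resolve_right h8L))))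
    · rw [this]
      linarith [Real.exp_pos (-L)]

end Hilbert

/-! ### From random exchanges of pairs to independent samples. -/

open scoped MatrixOrder in
/-- A real positive semidefinite matrix is a Gram matrix. -/
lemma exists_feature {ι : Type*} [Fintype ι] [DecidableEq ι] {G : Matrix ι ι ℝ}
    (hG : G.PosSemidef) :
    ∃ φ : ι → EuclideanSpace ℝ ι, ∀ i j, inner ℝ (φ i) (φ j) = G i j := by
  obtain ⟨B, rfl⟩ := CStarAlgebra.nonneg_iff_eq_star_mul_self.1 hG.nonneg
  refine ⟨fun i => WithLp.toLp 2 fun a => B a i, fun i j => ?_⟩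
  simp [PiLp.inner_apply, Matrix.mul_apply, Matrix.star_eq_conjTranspose, mul_comm]

section Generalization

variable {X : Type*} {N : ℕ}

/-- The absolute loss at `u` of the clipped kernel expansion with coefficients `α x` and centers
`x`. -/
noncomputable def expansionLoss (k : X → X → ℝ) (α : (Fin N → X) → Fin N → ℝ) (f : X → ℝ)
    (x : Fin N → X) (u : X) : ℝ :=
  |clip (∑ i, α x i * k (x i) u) - f u|

/-- The complexity of the kernel expansion with coefficients `α x` and centers `x`, relative to the
sample `x`. -/
noncomputable def expansionComplexity (k : X → X → ℝ) (α : (Fin N → X) → Fin N → ℝ)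
    (x : Fin N → X) : ℝ :=
  √(∑ i, ∑ j, α x i * α x j * k (x i) (x j)) * √(∑ i, k (x i) (x i))

/-- Exchange the two elements of the pairs selected by `σ`. -/
def swapPairs (σ : Fin N → Bool) (p : Fin N → X × X) : Fin N → X × X :=
  fun i => if σ i then (p i).swap else p i

/-- A finite version of the generalization bound: most exchanges of the elements of `N` given pairs
of points yield a good split into training and test points. -/
lemma cubeProb_swapPairs_le {k : X → X → ℝ} (hk : IsKernel k) (α : (Fin N → X) → Fin N → ℝ)
    {f : X → ℝ} (hf : ∀ u, |f u| ≤ 1) {L : ℝ} (hL : 1 ≤ L) (hLN : L ≤ N) (p : Fin N → X × X) :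
    cubeProb N (fun σ =>
      40 * (expansionComplexity k α (fun i => (swapPairs σ p i).1) + √(N * L)) <
        ∑ i, (expansionLoss k α f (fun i => (swapPairs σ p i).1) (swapPairs σ p i).2 -
          expansionLoss k α f (fun i => (swapPairs σ p i).1) (swapPairs σ p i).1)) ≤
      2 * Real.exp (-L) := by
  set P : Fin N × Bool → X := fun q => if q.2 then (p q.1).2 else (p q.1).1 with hP
  -- Only the `2N` given points matter, so a Euclidean feature space suffices in place of the full
  -- reproducing kernel space.
  obtain ⟨φ, hφ⟩ := exists_feature (Matrix.PosSemidef.submatrix hk P)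
  simp only [Matrix.submatrix_apply, Matrix.of_apply] at hφ
  have e1 : ∀ σ i, (swapPairs σ p i).1 = P (i, σ i) := fun σ i => by
    cases h : σ i <;> simp [swapPairs, hP, h]
  have e2 : ∀ σ i, (swapPairs σ p i).2 = P (i, !σ i) := fun σ i => by
    cases h : σ i <;> simp [swapPairs, hP, h]
  simp only [e1, e2]
  set w : (Fin N → Bool) → EuclideanSpace ℝ (Fin N × Bool) := fun σ =>
    ∑ i, α (fun i => P (i, σ i)) i • φ (i, σ i) with hw
  have hinner : ∀ σ q, inner ℝ (w σ) (φ q) =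
      ∑ i, α (fun i => P (i, σ i)) i * k (P (i, σ i)) (P q) := fun σ q => by
    simp only [hw, sum_inner, real_inner_smul_left, hφ]
  have hnorm : ∀ σ, ‖w σ‖ = √(∑ i, ∑ j, α (fun i => P (i, σ i)) i * α (fun i => P (i, σ i)) j *
      k (P (i, σ i)) (P (j, σ j))) := fun σ => by
    rw [norm_eq_sqrt_real_inner]
    congr 1
    conv_lhs => rw [hw]
    simp only [inner_sum, sum_inner, real_inner_smul_left, real_inner_smul_right, hφ]
    rw [Finset.sum_comm]
    exact Finset.sum_congr rfl fun i _ => Finset.sum_congr rfl fun j _ => by ring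
  have hdiag : ∀ q, ‖φ q‖ ^ 2 = k (P q) (P q) := fun q => by
    rw [← real_inner_self_eq_norm_sq, hφ]
  have := cubeProb_gap_le (fun i b => φ (i, b)) (fun i b => f (P (i, b)))
    (fun i b => hf _) w hL hLN
  simpa only [expansionLoss, expansionComplexity, hinner, hnorm, hdiag] using this

variable [MeasurableSpace X]

lemma measurable_clip : Measurable clip := by
  unfold clip
  fun_prop

variable {k : X → X → ℝ} {α : (Fin N → X) → Fin N → ℝ} {f : X → ℝ}

lemma measurable_expansionLoss (hkm : Measurable fun p : X × X => k p.1 p.2) (hα : Measurable α)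
    (hfm : Measurable f) {Ω : Type*} [MeasurableSpace Ω] {a : Ω → Fin N → X} (ha : Measurable a)
    {b : Ω → X} (hb : Measurable b) : Measurable fun ω => expansionLoss k α f (a ω) (b ω) := by
  have h1 : ∀ i, Measurable fun ω => k (a ω i) (b ω) := fun i =>
    hkm.comp (((measurable_pi_apply i).comp ha).prodMk hb)
  have h2 : ∀ i, Measurable fun ω => α (a ω) i := fun i =>
    (measurable_pi_apply i).comp (hα.comp ha)
  have h3 : Measurable fun ω => clip (∑ i, α (a ω) i * k (a ω i) (b ω)) :=
    measurable_clip.comp (Finset.measurable_sum _ fun i _ => (h2 i).mul (h1 i))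
  exact measurable_norm.comp (h3.sub (hfm.comp hb))

lemma measurable_expansionComplexity (hkm : Measurable fun p : X × X => k p.1 p.2)
    (hα : Measurable α) {Ω : Type*} [MeasurableSpace Ω] {a : Ω → Fin N → X} (ha : Measurable a) :
    Measurable fun ω => expansionComplexity k α (a ω) := by
  have h1 : ∀ i j, Measurable fun ω => k (a ω i) (a ω j) := fun i j =>
    hkm.comp (((measurable_pi_apply i).comp ha).prodMk ((measurable_pi_apply j).comp ha))
  have h2 : ∀ i, Measurable fun ω => α (a ω) i := fun i =>
    (measurable_pi_apply i).comp (hα.comp ha)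
  unfold expansionComplexity
  exact (Finset.measurable_sum _ fun i _ => Finset.measurable_sum _ fun j _ =>
    ((h2 i).mul (h2 j)).mul (h1 i j)).sqrt.mul (Finset.measurable_sum _ fun i _ => h1 i i).sqrt

lemma measurePreserving_swapPairs (μ : Measure X) [IsProbabilityMeasure μ] (σ : Fin N → Bool) :
    MeasurePreserving (swapPairs σ) (Measure.pi fun _ : Fin N => μ.prod μ)
      (Measure.pi fun _ : Fin N => μ.prod μ) := by
  refine measurePreserving_pi _ _ (f := fun i (q : X × X) => if σ i then q.swap else q) fun i => ?_
  cases σ i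
  · simpa using! MeasurePreserving.id (μ.prod μ)
  · simpa using Measure.measurePreserving_swap

/-- The bound for the difference between test and training losses on two independent samples. -/
lemma pi_prod_gap_le (μ : Measure X) [IsProbabilityMeasure μ] (hk : IsKernel k)
    (hkm : Measurable fun p : X × X => k p.1 p.2) (hα : Measurable α) (hfm : Measurable f)
    (hf : ∀ u, |f u| ≤ 1) {L : ℝ} (hL : 1 ≤ L) (hLN : L ≤ N) :
    (Measure.pi fun _ : Fin N => μ.prod μ)
      {p | 40 * (expansionComplexity k α (fun i => (p i).1) + √(N * L)) <
        ∑ i, (expansionLoss k α f (fun i => (p i).1) (p i).2 -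
          expansionLoss k α f (fun i => (p i).1) (p i).1)} ≤
      ENNReal.ofReal (2 * Real.exp (-L)) := by
  classical
  set E : Set (Fin N → X × X) :=
    {p | 40 * (expansionComplexity k α (fun i => (p i).1) + √(N * L)) <
        ∑ i, (expansionLoss k α f (fun i => (p i).1) (p i).2 -
          expansionLoss k α f (fun i => (p i).1) (p i).1)} with hE
  set P := Measure.pi fun _ : Fin N => μ.prod μ
  have hfst : Measurable fun (p : Fin N → X × X) (i : Fin N) => (p i).1 := by fun_prop
  have hEm : MeasurableSet E := by
    refine measurableSet_lt ?_ ?_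
    · exact ((measurable_expansionComplexity hkm hα hfst).add_const _).const_mul _
    · exact Finset.measurable_sum _ fun i _ =>
        (measurable_expansionLoss hkm hα hfm hfst (by fun_prop)).sub
          (measurable_expansionLoss hkm hα hfm hfst (by fun_prop))
  have hpt : ∀ p, ∑ σ : Fin N → Bool, (swapPairs σ ⁻¹' E).indicator (1 : (Fin N → X × X) → ENNReal) p ≤
      2 ^ N * ENNReal.ofReal (2 * Real.exp (-L)) := by
    intro p
    have h := cubeProb_swapPairs_le hk α hf hL hLN p
    rw [cubeProb, cubeAvg, div_le_iff₀ (by positivity), mul_comm (2 * Real.exp (-L))] at h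
    have h' := ENNReal.ofReal_le_ofReal h
    rw [ENNReal.ofReal_mul (by positivity), ENNReal.ofReal_sum_of_nonneg
      (fun σ _ => by split_ifs <;> norm_num)] at h'
    convert h' using 1
    · refine Finset.sum_congr rfl fun σ _ => ?_
      by_cases hσ : swapPairs σ p ∈ E
      · rw [Set.indicator_of_mem (by exact hσ), if_pos (by exact hσ)]
        simp
      · rw [Set.indicator_of_notMem (by exact hσ), if_neg (by exact hσ)]
        simp
    · rw [ENNReal.ofReal_pow (by norm_num), ENNReal.ofReal_ofNat]
  -- Every exchange preserves the product measure, so `2 ^ N * P E` is the expected number of bad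
  -- exchanges, bounded pointwise by `hpt`.
  have hmain : 2 ^ N * P E ≤ 2 ^ N * ENNReal.ofReal (2 * Real.exp (-L)) := by
    calc 2 ^ N * P E = ∑ σ : Fin N → Bool, P (swapPairs σ ⁻¹' E) := by
          rw [Finset.sum_congr rfl fun σ _ =>
            (measurePreserving_swapPairs μ σ).measure_preimage hEm.nullMeasurableSet]
          simp [P]
      _ = ∫⁻ p, ∑ σ : Fin N → Bool, (swapPairs σ ⁻¹' E).indicator (1 : (Fin N → X × X) → ENNReal) p ∂P := by
          have hm : ∀ σ : Fin N → Bool, MeasurableSet (swapPairs σ ⁻¹' E) := fun σ =>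
            (measurePreserving_swapPairs μ σ).measurable hEm
          rw [lintegral_finsetSum _ fun σ _ => measurable_one.indicator (hm σ)]
          exact Finset.sum_congr rfl fun σ _ => (lintegral_indicator_one (hm σ)).symm
      _ ≤ ∫⁻ _, 2 ^ N * ENNReal.ofReal (2 * Real.exp (-L)) ∂P := lintegral_mono hpt
      _ = _ := by simp [P]
  exact (ENNReal.mul_le_mul_iff_right (by simp) (by simp)).1 hmain

/-- A sample mean is at least about the expectation, with probability at least one half. -/
lemma half_le_pi_sum_ge (μ : Measure X) [IsProbabilityMeasure μ] (hN : 0 < N) {g : X → ℝ}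
    (hg : Measurable g) (hg0 : ∀ u, 0 ≤ g u) (hg2 : ∀ u, g u ≤ 2) :
    1 / 2 ≤ (Measure.pi fun _ : Fin N => μ) {x | N * ∫ u, g u ∂μ - √(2 * N) < ∑ i, g (x i)} := by
  set ν := Measure.pi fun _ : Fin N => μ
  have hN' : (0 : ℝ) < N := by exact_mod_cast hN
  have hmem : MemLp g 2 μ :=
    memLp_of_bounded (Filter.Eventually.of_forall fun u => ⟨hg0 u, hg2 u⟩)
      hg.aestronglyMeasurable 2
  have hmemi : ∀ i, MemLp (fun x : Fin N → X => g (x i)) 2 ν := fun i =>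
    hmem.comp_measurePreserving (measurePreserving_eval _ i)
  -- A variable in `[0, 2]` has variance at most `1`; Chebyshev at `√(2 * N)` then loses exactly one
  -- half.
  have hvar : ProbabilityTheory.variance (∑ i, fun x : Fin N → X => g (x i)) ν ≤ N := by
    rw [ProbabilityTheory.variance_sum_pi (X := fun _ => g) fun _ => hmem]
    have : ProbabilityTheory.variance g μ ≤ ((2 - 0) / 2) ^ 2 :=
      ProbabilityTheory.variance_le_sq_of_bounded
        (Filter.Eventually.of_forall fun u => ⟨hg0 u, hg2 u⟩) hg.aemeasurable
    rw [Finset.sum_const, nsmul_eq_mul, Finset.card_univ, Fintype.card_fin]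
    nlinarith
  have hmean : ∫ x, (∑ i, fun x : Fin N → X => g (x i)) x ∂ν = N * ∫ u, g u ∂μ := by
    simp only [Finset.sum_apply]
    rw [integral_finsetSum _ fun i _ => (hmemi i).integrable (by norm_num)]
    have : ∀ i, ∫ x : Fin N → X, g (x i) ∂ν = ∫ u, g u ∂μ := fun i =>
      integral_comp_eval hg.aestronglyMeasurable
    simp [this]
  have hcheb := ProbabilityTheory.meas_ge_le_variance_div_sq
    (memLp_finsetSum' Finset.univ fun i _ => hmemi i) (c := √(2 * N))
    (Real.sqrt_pos.2 (by positivity))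
  rw [hmean, Real.sq_sqrt (by positivity)] at hcheb
  set B : Set (Fin N → X) :=
    {x | √(2 * N) ≤ |(∑ i, fun x : Fin N → X => g (x i)) x - N * ∫ u, g u ∂μ|} with hB
  have hB2 : ν B ≤ 1 / 2 := by
    refine hcheb.trans ?_
    rw [← ENNReal.ofReal_one, ← ENNReal.ofReal_ofNat 2, ← ENNReal.ofReal_div_of_pos (by norm_num)]
    apply ENNReal.ofReal_le_ofReal
    rw [div_le_div_iff₀ (by positivity) (by norm_num)]
    linarith
  have hcover : 1 ≤ ν {x | N * ∫ u, g u ∂μ - √(2 * N) < ∑ i, g (x i)} + ν B := by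
    rw [← measure_univ (μ := ν)]
    refine (measure_mono fun x _ => ?_).trans (measure_union_le _ _)
    rcases lt_or_ge (N * ∫ u, g u ∂μ - √(2 * N)) (∑ i, g (x i)) with h | h
    · exact Or.inl h
    · refine Or.inr ?_
      simp only [hB, Set.mem_ofPred_eq, Finset.sum_apply]
      rw [abs_sub_comm]
      exact (by linarith : √(2 * N) ≤ N * ∫ u, g u ∂μ - ∑ i, g (x i)).trans (le_abs_self _)
  by_contra! hlt
  have : ν {x | N * ∫ u, g u ∂μ - √(2 * N) < ∑ i, g (x i)} + ν B < 1 / 2 + 1 / 2 :=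
    ENNReal.add_lt_add_of_lt_of_le (hB2.trans_lt (by simp)).ne hlt hB2
  rw [ENNReal.add_halves] at this
  exact absurd hcover (not_le.2 this)

/-- A generalization bound for clipped kernel expansions whose coefficients depend measurably on
the sample. -/
theorem pi_generalization_gap_le (μ : Measure X) [IsProbabilityMeasure μ] (hN : 0 < N)
    (hk : IsKernel k) (hkm : Measurable fun p : X × X => k p.1 p.2) (hα : Measurable α)
    (hfm : Measurable f) (hf : ∀ u, |f u| ≤ 1) {L : ℝ} (hL : 1 ≤ L) :
    (Measure.pi fun _ : Fin N => μ)
      {x | 42 * (expansionComplexity k α x + √(N * L)) <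
        N * ∫ u, expansionLoss k α f x u ∂μ - ∑ i, expansionLoss k α f x (x i)} ≤
      ENNReal.ofReal (4 * Real.exp (-L)) := by
  have hN' : (0 : ℝ) < N := by exact_mod_cast hN
  have hl0 : ∀ x u, 0 ≤ expansionLoss k α f x u := fun x u => abs_nonneg _
  have hl2 : ∀ x u, expansionLoss k α f x u ≤ 2 := fun x u => abs_clip_sub_le_two _ (hf u)
  have hQ0 : ∀ x, 0 ≤ expansionComplexity k α x := fun x => by
    unfold expansionComplexity; positivity
  have hlm : ∀ x, Measurable (expansionLoss k α f x) := fun x =>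
    measurable_expansionLoss hkm hα hfm measurable_const measurable_id
  -- For `L > N` the deviation term exceeds `N`, while the total loss is at most `2 * N`: the event
  -- is empty.
  rcases lt_or_ge (N : ℝ) L with hLN | hLN
  · refine (measure_mono_null (t := ∅) (fun x hx => ?_) measure_empty).le.trans zero_le
    simp only [Set.mem_ofPred_eq] at hx
    have h1 : ∫ u, expansionLoss k α f x u ∂μ ≤ 2 := by
      have := integral_mono_of_nonneg (μ := μ) (Filter.Eventually.of_forall (hl0 x))
        (integrable_const (2 : ℝ)) (Filter.Eventually.of_forall (hl2 x))
      simpa using this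
    have h2 : 0 ≤ ∑ i, expansionLoss k α f x (x i) := Finset.sum_nonneg fun i _ => hl0 _ _
    have h3 : (N : ℝ) ≤ √(N * L) := Real.le_sqrt_of_sq_le (by nlinarith)
    have := hQ0 x
    nlinarith
  set ν := Measure.pi fun _ : Fin N => μ
  set E : Set ((Fin N → X) × (Fin N → X)) :=
    {q | 40 * (expansionComplexity k α q.1 + √(N * L)) <
        ∑ i, (expansionLoss k α f q.1 (q.2 i) - expansionLoss k α f q.1 (q.1 i))} with hE
  have hEm : MeasurableSet E := by
    refine measurableSet_lt ?_ ?_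
    · exact ((measurable_expansionComplexity hkm hα measurable_fst).add_const _).const_mul _
    · exact Finset.measurable_sum _ fun i _ =>
        (measurable_expansionLoss hkm hα hfm measurable_fst (by fun_prop)).sub
          (measurable_expansionLoss hkm hα hfm measurable_fst (by fun_prop))
  have hEle : (ν.prod ν) E ≤ ENNReal.ofReal (2 * Real.exp (-L)) := by
    rw [← (measurePreserving_arrowProdEquivProdArrow X X (Fin N) (fun _ => μ)
      (fun _ => μ)).measure_preimage hEm.nullMeasurableSet]
    exact pi_prod_gap_le μ hk hkm hα hfm hf hL hLN
  -- For a bad `x`, a ghost sample shows the gap with probability at least one half. Its fluctuation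
  -- `√(2 * N) ≤ 2 * √(N * L)` accounts for `42` against `40`, and Markov's inequality then doubles
  -- the failure probability.
  have hhalf : ν {x | 42 * (expansionComplexity k α x + √(N * L)) <
        N * ∫ u, expansionLoss k α f x u ∂μ - ∑ i, expansionLoss k α f x (x i)} ≤
      ν {x | 1 / 2 ≤ ν (Prod.mk x ⁻¹' E)} := by
    refine measure_mono fun x hx => ?_
    simp only [Set.mem_ofPred_eq] at hx ⊢
    refine (half_le_pi_sum_ge μ hN (hlm x) (hl0 x) (hl2 x)).trans (measure_mono fun x' hx' => ?_)
    simp only [hE, Set.mem_preimage, Set.mem_ofPred_eq, Finset.sum_sub_distrib] at hx' ⊢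
    have h2 : √(2 * N) ≤ 2 * √(N * L) := by
      rw [Real.sqrt_le_left (by positivity), mul_pow, Real.sq_sqrt (by positivity)]
      nlinarith
    linarith [hQ0 x]
  have hmarkov : 1 / 2 * ν {x | 1 / 2 ≤ ν (Prod.mk x ⁻¹' E)} ≤ (ν.prod ν) E := by
    rw [Measure.prod_apply hEm]
    exact mul_meas_ge_le_lintegral (measurable_measure_prodMk_left hEm) _
  calc _ ≤ ν {x | 1 / 2 ≤ ν (Prod.mk x ⁻¹' E)} := hhalf
    _ = 2 * (1 / 2 * ν {x | 1 / 2 ≤ ν (Prod.mk x ⁻¹' E)}) := by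
        rw [← mul_assoc, one_div, ENNReal.mul_inv_cancel (by simp) (by simp), one_mul]
    _ ≤ 2 * ENNReal.ofReal (2 * Real.exp (-L)) := by gcongr; exact hmarkov.trans hEle
    _ = _ := by
        rw [← ENNReal.ofReal_ofNat 2, ← ENNReal.ofReal_mul (by norm_num)]
        congr 1
        ring

end Generalization

/-! ### Expectation values and traces on two copies. -/

section Quantum

variable {d : Type*} [Fintype d]

open scoped MatrixOrder in
/-- The expectation values of an observable of norm at most one are at most one. -/
lemma abs_expVal_le_one [DecidableEq d] {A ρ : Matrix d d ℂ} (hA : IsBoundedObservable A)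
    (hρ : IsDensityMatrix ρ) : |expVal A ρ| ≤ 1 := by
  obtain ⟨hpos, htr⟩ := hρ
  obtain ⟨B, rfl⟩ := CStarAlgebra.nonneg_iff_eq_star_mul_self.1 hpos.nonneg
  rw [Matrix.star_eq_conjTranspose] at htr
  -- With `ρ = Bᴴ * B`, the conjugated rows of `B` are unnormalized pure states whose squared norms
  -- add up to the trace of `ρ`.
  set v : d → EuclideanSpace ℂ d := fun i => WithLp.toLp 2 fun a => star (B i a) with hv
  have hnorm : ∑ i, ‖v i‖ ^ 2 = 1 := by
    have h : ((∑ i, ‖v i‖ ^ 2 : ℝ) : ℂ) = 1 := by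
      rw [← htr, Matrix.trace_mul_comm, Matrix.trace]
      push_cast
      refine Finset.sum_congr rfl fun i _ => ?_
      rw [← Complex.ofReal_pow, EuclideanSpace.norm_sq_eq]
      push_cast
      simp [hv, Matrix.mul_apply, Complex.mul_conj']
    exact_mod_cast h
  have htrace : (A * (Bᴴ * B)).trace =
      ∑ i, inner ℂ (v i) (Matrix.toEuclideanCLM (n := d) (𝕜 := ℂ) A (v i)) := by
    rw [← Matrix.mul_assoc, Matrix.trace_mul_comm, Matrix.trace]
    refine Finset.sum_congr rfl fun i _ => ?_
    rw [PiLp.inner_apply, Matrix.diag_apply, Matrix.mul_apply]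
    refine Finset.sum_congr rfl fun a _ => ?_
    simp [hv, Matrix.mul_apply, Matrix.mulVec, dotProduct, mul_comm]
  rw [expVal, Matrix.star_eq_conjTranspose, htrace]
  refine (Complex.abs_re_le_norm _).trans ((norm_sum_le _ _).trans ?_)
  rw [← hnorm]
  refine Finset.sum_le_sum fun i _ => (norm_inner_le_norm _ _).trans ?_
  rw [sq]
  refine mul_le_mul_of_nonneg_left ?_ (norm_nonneg _)
  refine (ContinuousLinearMap.le_opNorm _ _).trans ?_
  exact mul_le_of_le_one_left (norm_nonneg _) hA.2

lemma isHermitian_heisenberg {O : Matrix d d ℂ} (hO : O.IsHermitian) (U : Matrix d d ℂ) :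
    (heisenberg U O).IsHermitian :=
  Matrix.isHermitian_conjTranspose_mul_mul U hO

/-- Cyclicity of the trace moves the unitary from the observable to the state, which stays a density
matrix. -/
lemma abs_expVal_heisenberg_le_one [DecidableEq d] {O U ρ : Matrix d d ℂ} (hO : IsBoundedObservable O)
    (hU : U ∈ Matrix.unitaryGroup d ℂ) (hρ : IsDensityMatrix ρ) :
    |expVal (heisenberg U O) ρ| ≤ 1 := by
  have e : expVal (heisenberg U O) ρ = expVal O (U * ρ * Uᴴ) := by
    rw [expVal, expVal, heisenberg, Matrix.mul_assoc, Matrix.mul_assoc, Matrix.trace_mul_comm]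
    simp only [Matrix.mul_assoc]
  rw [e]
  refine abs_expVal_le_one hO ⟨hρ.1.mul_mul_conjTranspose_same U, ?_⟩
  rw [Matrix.trace_mul_comm, ← Matrix.mul_assoc, ← Matrix.star_eq_conjTranspose,
    Matrix.mem_unitaryGroup_iff'.1 hU, Matrix.one_mul, hρ.2]

lemma measurable_expVal {X : Type*} [MeasurableSpace X] (A : Matrix d d ℂ)
    {ρ : X → Matrix d d ℂ} (hρ : ∀ a b, Measurable fun u => ρ u a b) :
    Measurable fun u => expVal A (ρ u) := by
  simp only [expVal, Matrix.trace, Matrix.diag_apply, Matrix.mul_apply]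
  exact Complex.measurable_re.comp (Finset.measurable_sum _ fun a _ =>
    Finset.measurable_sum _ fun b _ => (hρ b a).const_mul _)

lemma trace_mul_eq_expVal {A ρ : Matrix d d ℂ} (hA : A.IsHermitian) (hρ : ρ.IsHermitian) :
    (ρ * A).trace = expVal A ρ := by
  rw [Matrix.trace_mul_comm, expVal]
  refine (Complex.conj_eq_iff_re.1 ?_).symm
  rw [starRingEnd_apply, ← Matrix.trace_conjTranspose, Matrix.conjTranspose_mul, hA.eq, hρ.eq,
    Matrix.trace_mul_comm]

variable {X : Type*} {N : ℕ}

/-- The trace of a Kronecker product factors, so the two-copy operators become quadratic forms in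
the labels. -/
lemma pairTrace_pairOperator (M : Matrix (Fin N) (Fin N) ℝ) {A : Matrix d d ℂ}
    (hA : A.IsHermitian) {ρ : X → Matrix d d ℂ} (hρ : ∀ u, (ρ u).IsHermitian) (x : Fin N → X) :
    pairTrace (pairOperator M ρ x) A =
      (fun i => expVal A (ρ (x i))) ⬝ᵥ (M *ᵥ fun i => expVal A (ρ (x i))) := by
  have h : (pairOperator M ρ x * (A ⊗ₖ A)).trace =
      ((∑ i, ∑ j, M i j * (expVal A (ρ (x i)) * expVal A (ρ (x j))) : ℝ) : ℂ) := by
    simp only [pairOperator, Finset.sum_mul, Matrix.smul_mul, ← Matrix.mul_kronecker_mul,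
      Matrix.trace_sum, Matrix.trace_smul, Matrix.trace_kronecker,
      trace_mul_eq_expVal hA (hρ _)]
    push_cast
    rfl
  rw [pairTrace, h, Complex.ofReal_re]
  simp only [dotProduct, Matrix.mulVec, Finset.mul_sum]
  exact Finset.sum_congr rfl fun i _ => Finset.sum_congr rfl fun j _ => by ring

lemma pairTrace_smul (c : ℝ) (B : Matrix (d × d) (d × d) ℂ) (A : Matrix d d ℂ) :
    pairTrace ((c : ℂ) • B) A = c * pairTrace B A := by
  simp [pairTrace]

end Quantum

/-! ### Algebra and measurability of kernel ridge regression. -/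

section Gram

variable {X : Type*} {N : ℕ} {k : X → X → ℝ}

lemma IsKernel.symm (hk : IsKernel k) (u v : X) : k u v = k v u := by
  have := hk.isHermitian.apply v u
  simpa using this

lemma IsKernel.scale (hk : IsKernel k) {c : ℝ} (hc : 0 ≤ c) : IsKernel (scale c k) :=
  Matrix.PosSemidef.smul (x := Matrix.of k) hk hc

lemma transpose_gram (hk : IsKernel k) (x : Fin N → X) : (gram k x)ᵀ = gram k x := by
  ext i j
  exact hk.symm _ _

lemma transpose_regGram_inv (hk : IsKernel k) (lam : ℝ) (x : Fin N → X) :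
    (regGram k lam x)⁻¹ᵀ = (regGram k lam x)⁻¹ := by
  rw [Matrix.transpose_nonsing_inv, regGram, Matrix.transpose_add, transpose_gram hk,
    Matrix.transpose_smul, Matrix.transpose_one]

/-- The coefficients of the kernel ridge regressor. -/
noncomputable def ridgeCoeff (k : X → X → ℝ) (lam : ℝ) (x : Fin N → X) (y : Fin N → ℝ) :
    Fin N → ℝ :=
  (regGram k lam x)⁻¹ *ᵥ y

lemma regressor_eq (lam : ℝ) (x : Fin N → X) (y : Fin N → ℝ) (u : X) :
    regressor k lam x y u = clip (∑ i, ridgeCoeff k lam x y i * k (x i) u) := by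
  rw [regressor, clip]
  congr 2
  refine Finset.sum_congr rfl fun i _ => ?_
  simp only [ridgeCoeff, Matrix.mulVec, dotProduct, Finset.sum_mul]
  exact Finset.sum_congr rfl fun j _ => by ring

/-- The residuals of kernel ridge regression are proportional to its coefficients. -/
lemma sum_ridgeCoeff_sub (hk : IsKernel k) {lam : ℝ} {x : Fin N → X}
    (hu : IsUnit (regGram k lam x)) (y : Fin N → ℝ) (j : Fin N) :
    ∑ i, ridgeCoeff k lam x y i * k (x i) (x j) - y j = -(lam * ridgeCoeff k lam x y j) := by
  have h : regGram k lam x *ᵥ ridgeCoeff k lam x y = y := by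
    rw [ridgeCoeff, Matrix.mulVec_mulVec,
      Matrix.mul_nonsing_inv _ ((Matrix.isUnit_iff_isUnit_det _).1 hu), Matrix.one_mulVec]
  have hj := congrFun h j
  rw [regGram, Matrix.add_mulVec, Matrix.smul_mulVec, Matrix.one_mulVec] at hj
  simp only [Pi.add_apply, Pi.smul_apply, smul_eq_mul, Matrix.mulVec, dotProduct, gram,
    Matrix.of_apply] at hj
  rw [← hj, Finset.sum_congr rfl fun i _ => by rw [mul_comm, hk.symm (x i) (x j)]]
  ring

/-- The training error of clipped kernel ridge regression. -/
lemma sum_abs_clip_ridge_sub_le (hk : IsKernel k) {lam : ℝ} {x : Fin N → X}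
    (hu : IsUnit (regGram k lam x)) {y : Fin N → ℝ} (hy : ∀ i, |y i| ≤ 1) :
    ∑ j, |clip (∑ i, ridgeCoeff k lam x y i * k (x i) (x j)) - y j| ≤
      √(N * (lam ^ 2 * (y ⬝ᵥ ((regGram k lam x)⁻¹ ^ 2 *ᵥ y)))) := by
  have hdot : y ⬝ᵥ ((regGram k lam x)⁻¹ ^ 2 *ᵥ y) = ∑ j, ridgeCoeff k lam x y j ^ 2 := by
    rw [sq, ← Matrix.mulVec_mulVec, Matrix.dotProduct_mulVec, ← Matrix.mulVec_transpose,
      transpose_regGram_inv hk]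
    exact Finset.sum_congr rfl fun j _ => (sq _).symm
  rw [hdot, Finset.mul_sum]
  apply Real.le_sqrt_of_sq_le
  refine (sq_sum_le_card_mul_sum_sq).trans ?_
  rw [Finset.card_univ, Fintype.card_fin]
  refine mul_le_mul_of_nonneg_left (Finset.sum_le_sum fun j _ => ?_) (Nat.cast_nonneg _)
  -- Clipping only brings the prediction closer to a label in `[-1, 1]`, so the unclipped residual
  -- bounds the loss.
  rw [← mul_pow, ← sq_abs (lam * _), ← abs_neg (lam * _), ← sum_ridgeCoeff_sub hk hu]
  exact pow_le_pow_left₀ (abs_nonneg _) (abs_clip_sub_le _ (hy j)) 2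

/-- The squared norm of the kernel ridge regressor. -/
lemma sum_ridgeCoeff_mul (hk : IsKernel k) (lam : ℝ) (x : Fin N → X) (y : Fin N → ℝ) :
    ∑ i, ∑ j, ridgeCoeff k lam x y i * ridgeCoeff k lam x y j * k (x i) (x j) =
      y ⬝ᵥ (((regGram k lam x)⁻¹ * gram k x * (regGram k lam x)⁻¹) *ᵥ y) := by
  rw [Matrix.mul_assoc, ← Matrix.mulVec_mulVec, Matrix.dotProduct_mulVec,
    ← Matrix.mulVec_transpose, transpose_regGram_inv hk, ← Matrix.mulVec_mulVec]
  simp only [← ridgeCoeff.eq_def, dotProduct]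
  refine Finset.sum_congr rfl fun i _ => ?_
  simp only [Matrix.mulVec, dotProduct, Finset.mul_sum, gram, Matrix.of_apply]
  exact Finset.sum_congr rfl fun j _ => by ring

lemma trace_gram (k : X → X → ℝ) (x : Fin N → X) : (gram k x).trace = ∑ i, k (x i) (x i) := rfl

variable [MeasurableSpace X]

/-- By the adjugate formula the entries are measurable even across singular matrices, where the
inverse is zero. -/
lemma measurable_matrix_inv_apply {Ω : Type*} [MeasurableSpace Ω] {n : Type*} [Fintype n]
    [DecidableEq n] {M : Ω → Matrix n n ℝ} (hM : ∀ i j, Measurable fun ω => M ω i j) (i j : n) :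
    Measurable fun ω => (M ω)⁻¹ i j := by
  have hdet : ∀ {M : Ω → Matrix n n ℝ} (_ : ∀ i j, Measurable fun ω => M ω i j),
      Measurable fun ω => (M ω).det := by
    intro M hM
    simp only [Matrix.det_apply]
    exact Finset.measurable_sum _ fun σ _ =>
      (Finset.measurable_prod _ fun i _ => hM _ _).const_smul _
  simp only [Matrix.inv_def, Ring.inverse_eq_inv', Matrix.smul_apply, smul_eq_mul,
    Matrix.adjugate_apply]
  refine (hdet hM).inv.mul (hdet fun a b => ?_)
  by_cases hab : a = j
  · subst hab
    simp only [Matrix.updateRow_self]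
    exact measurable_const
  · simp only [Matrix.updateRow_ne hab]
    exact hM a b

lemma measurable_scaled_ridgeCoeff (hkm : Measurable fun p : X × X => k p.1 p.2) (lam : ℝ)
    {f : X → ℝ} (hf : Measurable f) {c : (Fin N → X) → ℝ} (hc : Measurable c) :
    Measurable fun x : Fin N → X =>
      c x • ridgeCoeff (scale (c x) k) lam x (fun i => f (x i)) := by
  have hkij : ∀ i j, Measurable fun x : Fin N → X => k (x i) (x j) := fun i j =>
    hkm.comp (f := fun x : Fin N → X => (x i, x j)) (by fun_prop)
  refine hc.smul (measurable_pi_iff.2 fun i => ?_)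
  simp only [ridgeCoeff, Matrix.mulVec, dotProduct]
  refine Finset.measurable_sum _ fun j _ => Measurable.mul ?_ (hf.comp (measurable_pi_apply j))
  refine measurable_matrix_inv_apply (fun a b => ?_) i j
  simp only [regGram, gram, scale, Matrix.add_apply, Matrix.of_apply, Matrix.smul_apply]
  exact (hc.mul (hkij a b)).add_const _

end Gram

/-! ### The generalization bound for ridge regression. -/

section Ridge

variable {X : Type*} [MeasurableSpace X] {d : Type*} [Fintype d] {N : ℕ}

/-- The generalization bound for clipped kernel ridge regression on expectation values. -/
theorem predError_le (μ : Measure X) [IsProbabilityMeasure μ] {A : Matrix d d ℂ}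
    (hA : A.IsHermitian) {ρ : X → Matrix d d ℂ} (hρ : ∀ u, (ρ u).IsHermitian)
    (hρA : ∀ u, |expVal A (ρ u)| ≤ 1) (hρm : ∀ a b, Measurable fun u => ρ u a b)
    {k : X → X → ℝ} (hk : IsKernel k) (hkm : Measurable fun p : X × X => k p.1 p.2)
    (hN : 0 < N) (lam : ℝ) {L : ℝ} (hL : 1 ≤ L) :
    ENNReal.ofReal (1 - 4 * Real.exp (-L)) ≤ (Measure.pi fun _ : Fin N => μ)
      {x | ∀ c : ℝ, 0 < c → (gram (scale c k) x).trace = N →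
        IsUnit (regGram (scale c k) lam x) →
        predError μ ρ A (scale c k) lam x ≤
          42 * (√(pairTrace (Atra (scale c k) lam ρ x) A / N) +
            √(pairTrace (Agen (scale c k) lam ρ x) A / N) + √(L / N))} := by
  have hN' : (0 : ℝ) < N := by exact_mod_cast hN
  set ν := Measure.pi fun _ : Fin N => μ
  set f : X → ℝ := fun u => expVal A (ρ u) with hf
  have hfm : Measurable f := measurable_expVal A hρm
  set T : (Fin N → X) → ℝ := fun x => ∑ i, k (x i) (x i) with hT
  have hTm : Measurable T := Finset.measurable_sum _ fun i _ =>
    hkm.comp (f := fun x : Fin N → X => (x i, x i)) (by fun_prop)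
  -- The trace condition forces `c = N / T x`, so one measurable coefficient map covers all `c`. The
  -- outer factor rewrites the expansion in terms of the unscaled kernel. If `T x = 0`, no `c` is
  -- admissible.
  set α : (Fin N → X) → Fin N → ℝ := fun x =>
    (N / T x) • ridgeCoeff (scale (N / T x) k) lam x (fun i => f (x i)) with hα
  have hαm : Measurable α := measurable_scaled_ridgeCoeff hkm lam hfm (hTm.const_div _)
  set B : Set (Fin N → X) := {x | 42 * (expansionComplexity k α x + √(N * L)) <
        N * ∫ u, expansionLoss k α f x u ∂μ - ∑ i, expansionLoss k α f x (x i)} with hB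
  have hBle : ν B ≤ ENNReal.ofReal (4 * Real.exp (-L)) :=
    pi_generalization_gap_le μ hN hk hkm hαm hfm hρA hL
  have hgood : ENNReal.ofReal (1 - 4 * Real.exp (-L)) ≤ ν Bᶜ := by
    rw [ENNReal.ofReal_sub _ (by positivity), ENNReal.ofReal_one, tsub_le_iff_right]
    calc (1 : ENNReal) = ν (Bᶜ ∪ B) := by rw [Set.compl_union_self, measure_univ]
      _ ≤ ν Bᶜ + ν B := measure_union_le _ _
      _ ≤ _ := by gcongr
  -- Monotonicity of the measure is enough here; the target set need not be measurable.
  refine hgood.trans (measure_mono fun x hx c hc htr hu => ?_)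
  have hx' : N * ∫ u, expansionLoss k α f x u ∂μ - ∑ i, expansionLoss k α f x (x i) ≤
      42 * (expansionComplexity k α x + √(N * L)) := not_lt.1 fun h => hx h
  set y : Fin N → ℝ := fun i => f (x i) with hy
  have hcT : c * T x = N := by
    rw [← htr, trace_gram, hT]
    simp only [scale, Finset.mul_sum]
  have hT0 : T x ≠ 0 := by
    intro h
    rw [h, mul_zero] at hcT
    exact hN'.ne hcT
  have hc' : N / T x = c := by rw [← hcT, mul_div_cancel_right₀ _ hT0]
  have hT0' : 0 ≤ T x := by
    by_contra! h
    nlinarith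
  have hkc := hk.scale hc.le
  have hαx : α x = c • ridgeCoeff (scale c k) lam x y := by
    simp only [hα, hc', hy]
  have hsum : ∀ u, ∑ i, α x i * k (x i) u =
      ∑ i, ridgeCoeff (scale c k) lam x y i * scale c k (x i) u := fun u => by
    rw [hαx]
    refine Finset.sum_congr rfl fun i _ => ?_
    simp only [Pi.smul_apply, smul_eq_mul, scale]
    ring
  have hloss : ∀ u, expansionLoss k α f x u =
      |regressor (scale c k) lam x y u - expVal A (ρ u)| := fun u => by
    rw [expansionLoss, hsum, regressor_eq]
  have hgen : pairTrace (Agen (scale c k) lam ρ x) A =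
      ∑ i, ∑ j, ridgeCoeff (scale c k) lam x y i * ridgeCoeff (scale c k) lam x y j *
        scale c k (x i) (x j) := by
    rw [Agen, pairTrace_pairOperator _ hA hρ, sum_ridgeCoeff_mul hkc]
  have hcomp : expansionComplexity k α x =
      √(N * pairTrace (Agen (scale c k) lam ρ x) A) := by
    rw [expansionComplexity, ← Real.sqrt_mul' _ hT0', hgen, ← hcT, hαx]
    congr 1
    simp only [Pi.smul_apply, smul_eq_mul, scale, Finset.mul_sum, Finset.sum_mul]
    exact Finset.sum_congr rfl fun i _ => Finset.sum_congr rfl fun j _ => by ring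
  have htrain : ∑ i, expansionLoss k α f x (x i) ≤
      √(N * pairTrace (Atra (scale c k) lam ρ x) A) := by
    rw [Atra, pairTrace_smul, pairTrace_pairOperator _ hA hρ]
    refine le_trans (le_of_eq ?_) (sum_abs_clip_ridge_sub_le hkc hu (y := y) fun i => hρA _)
    exact Finset.sum_congr rfl fun j _ => by rw [expansionLoss, hsum]
  have herr : ∫ u, expansionLoss k α f x u ∂μ = predError μ ρ A (scale c k) lam x := by
    rw [predError]
    exact integral_congr_ae (Filter.Eventually.of_forall hloss)
  rw [hcomp, herr] at hx'
  have hdiv : ∀ z : ℝ, √(N * z) = N * √(z / N) := fun z => by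
    have : (N : ℝ) * z = N ^ 2 * (z / N) := by field_simp
    rw [this, Real.sqrt_mul (by positivity), Real.sqrt_sq hN'.le]
  rw [hdiv] at htrain
  rw [hdiv, hdiv] at hx'
  have h0 := Real.sqrt_nonneg (pairTrace (Atra (scale c k) lam ρ x) A / N)
  refine le_of_mul_le_mul_left ?_ hN'
  nlinarith

end Ridge

/-! ### The case without regularization. -/

section Unregularized

variable {X : Type*} {d : Type*} {N : ℕ}

lemma regGram_zero (k : X → X → ℝ) (x : Fin N → X) : regGram k 0 x = gram k x := by
  simp [regGram]

lemma Atra_zero (k : X → X → ℝ) (ρ : X → Matrix d d ℂ) (x : Fin N → X) : Atra k 0 ρ x = 0 := by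
  simp [Atra]

lemma Agen_zero {k : X → X → ℝ} {x : Fin N → X} (hu : IsUnit (gram k x))
    (ρ : X → Matrix d d ℂ) : Agen k 0 ρ x = pairOperator (gram k x)⁻¹ ρ x := by
  rw [Agen, regGram_zero, Matrix.nonsing_inv_mul _ ((Matrix.isUnit_iff_isUnit_det _).1 hu),
    Matrix.one_mul]

lemma pairTrace_Agen_zero [Fintype d] {k : X → X → ℝ} {x : Fin N → X} (hu : IsUnit (gram k x))
    {A : Matrix d d ℂ} (hA : A.IsHermitian) {ρ : X → Matrix d d ℂ}
    (hρ : ∀ u, (ρ u).IsHermitian) : pairTrace (Agen k 0 ρ x) A = sK k ρ A x := by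
  rw [Agen_zero hu, pairTrace_pairOperator _ hA hρ, sK]
  simp only [dotProduct, Matrix.mulVec, Finset.mul_sum]
  exact Finset.sum_congr rfl fun i _ => Finset.sum_congr rfl fun j _ => by ring

end Unregularized

/-! ### Confidence levels and the main theorem. -/

/-- Confidence levels bounded away from one absorb constants in the deviation term. -/
lemma log_four_div_le {δ δ₁ : ℝ} (hδ : 0 < δ) (hδδ₁ : δ ≤ δ₁) (hδ₁ : δ₁ < 1) :
    Real.log (4 / δ) ≤ (1 + Real.log 4 / Real.log (1 / δ₁)) * Real.log (1 / δ) := by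
  have hδ₁0 : 0 < δ₁ := hδ.trans_le hδδ₁
  have h1 : 0 < Real.log (1 / δ₁) := Real.log_pos (by rwa [lt_div_iff₀ hδ₁0, one_mul])
  have h2 : Real.log (1 / δ₁) ≤ Real.log (1 / δ) := by gcongr
  have h3 : Real.log (4 / δ) = Real.log 4 + Real.log (1 / δ) := by
    rw [← Real.log_mul (by norm_num) (by positivity), mul_one_div]
  have h4 : Real.log 4 ≤ Real.log 4 / Real.log (1 / δ₁) * Real.log (1 / δ) := by
    rw [div_mul_eq_mul_div, le_div_iff₀ h1]
    exact mul_le_mul_of_nonneg_left h2 (Real.log_nonneg (by norm_num))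
  rw [h3, add_mul, one_mul]
  linarith

lemma one_le_log_four_div {δ : ℝ} (hδ : 0 < δ) (hδ1 : δ < 1) : 1 ≤ Real.log (4 / δ) := by
  rw [Real.le_log_iff_exp_le (by positivity), le_div_iff₀ hδ]
  nlinarith [Real.exp_one_lt_d9, Real.exp_pos 1]

end QKernel

theorem mainTheorem1 (δ₀ : ℝ) (hδ₀ : δ₀ < 1) :
    ∃ C : ℝ, 0 < C ∧
      ∀ (X : Type*) [MeasurableSpace X] (μ : Measure X) [IsProbabilityMeasure μ]
        (d : Type*) [Fintype d] [DecidableEq d]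
        (O : Matrix d d ℂ) (_ : QKernel.IsBoundedObservable O)
        (U : Matrix d d ℂ) (_ : U ∈ Matrix.unitaryGroup d ℂ)
        (ρ : X → Matrix d d ℂ) (_ : ∀ u, QKernel.IsDensityMatrix (ρ u))
        (_ : ∀ a b, Measurable fun u => ρ u a b)
        (k : X → X → ℝ) (_ : QKernel.IsKernel k)
        (_ : Measurable fun p : X × X => k p.1 p.2)
        (N : ℕ) (_ : 0 < N),
        -- the general bound, for every regularization parameter
        (∀ lam : ℝ, 0 ≤ lam → ∀ δ : ℝ, 0 < δ → δ ≤ δ₀ →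
          ENNReal.ofReal (1 - δ) ≤ Measure.pi (fun _ : Fin N => μ)
            {x | ∀ c : ℝ, 0 < c →
              (QKernel.gram (QKernel.scale c k) x).trace = N →
              IsUnit (QKernel.regGram (QKernel.scale c k) lam x) →
              QKernel.predError μ ρ (QKernel.heisenberg U O) (QKernel.scale c k) lam x ≤
                C * (√(QKernel.pairTrace (QKernel.Atra (QKernel.scale c k) lam ρ x)
                        (QKernel.heisenberg U O) / N)
                  + √(QKernel.pairTrace (QKernel.Agen (QKernel.scale c k) lam ρ x)
                        (QKernel.heisenberg U O) / N)
                  + √(Real.log (1 / δ) / N))}) ∧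
        -- the two operators without regularization
        (∀ (x : Fin N → X) (c : ℝ), IsUnit (QKernel.gram (QKernel.scale c k) x) →
          QKernel.Atra (QKernel.scale c k) 0 ρ x = 0 ∧
          QKernel.Agen (QKernel.scale c k) 0 ρ x =
            QKernel.pairOperator ((QKernel.gram (QKernel.scale c k) x)⁻¹) ρ x ∧
          QKernel.pairTrace (QKernel.Agen (QKernel.scale c k) 0 ρ x) (QKernel.heisenberg U O) =
            QKernel.sK (QKernel.scale c k) ρ (QKernel.heisenberg U O) x) ∧
        -- the bound without regularization, with probability 0.99
        ENNReal.ofReal 0.99 ≤ Measure.pi (fun _ : Fin N => μ)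
          {x | ∀ c : ℝ, 0 < c →
            (QKernel.gram (QKernel.scale c k) x).trace = N →
            IsUnit (QKernel.gram (QKernel.scale c k) x) →
            QKernel.predError μ ρ (QKernel.heisenberg U O) (QKernel.scale c k) 0 x ≤
              C * √(max 1 (QKernel.sK (QKernel.scale c k) ρ (QKernel.heisenberg U O) x) / N)} := by
  -- The maximum is positive, so `log (1 / δ₁)` is meaningful, and it admits the level `0.01` needed
  -- for the last claim.
  set δ₁ := max δ₀ (1 / 2) with hδ₁def
  have hδ₁ : δ₁ < 1 := max_lt hδ₀ (by norm_num)
  have hδ₁0 : 0 < δ₁ := lt_max_of_lt_right (by norm_num)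
  set κ := 1 + Real.log 4 / Real.log (1 / δ₁) with hκdef
  have hκ : 1 ≤ κ := by
    have h1 : 0 < Real.log (1 / δ₁) := Real.log_pos (by rwa [lt_div_iff₀ hδ₁0, one_mul])
    have h4 : 0 ≤ Real.log 4 := Real.log_nonneg (by norm_num)
    rw [hκdef]
    linarith [div_nonneg h4 h1.le]
  have hsκ : 1 ≤ √κ := Real.one_le_sqrt.2 hκ
  -- At `δ = 0.01` the deviation term is `√(log 100 / N)`; since `max 1 s ≥ 1`, it is absorbed into
  -- the constant.
  set M := 1 + √(Real.log 100) with hMdef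
  have hM : 1 ≤ M := by linarith [Real.sqrt_nonneg (Real.log 100)]
  refine ⟨42 * √κ * M, by positivity, ?_⟩
  intro X _ μ _ d _ _ O hO U hU ρ hρ hρm k hk hkm N hN
  have hN' : (0 : ℝ) < N := by exact_mod_cast hN
  have hA := QKernel.isHermitian_heisenberg hO.1 U
  have hρh : ∀ u, (ρ u).IsHermitian := fun u => (hρ u).1.isHermitian
  set A := QKernel.heisenberg U O
  have hρA : ∀ u, |QKernel.expVal A (ρ u)| ≤ 1 := fun u =>
    QKernel.abs_expVal_heisenberg_le_one hO hU (hρ u)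
  have bound : ∀ lam : ℝ, ∀ δ : ℝ, 0 < δ → δ ≤ δ₁ →
      ENNReal.ofReal (1 - δ) ≤ Measure.pi (fun _ : Fin N => μ)
        {x | ∀ c : ℝ, 0 < c → (QKernel.gram (QKernel.scale c k) x).trace = N →
          IsUnit (QKernel.regGram (QKernel.scale c k) lam x) →
          QKernel.predError μ ρ A (QKernel.scale c k) lam x ≤
            42 * √κ * (√(QKernel.pairTrace (QKernel.Atra (QKernel.scale c k) lam ρ x) A / N) +
              √(QKernel.pairTrace (QKernel.Agen (QKernel.scale c k) lam ρ x) A / N) +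
              √(Real.log (1 / δ) / N))} := by
    intro lam δ hδ hδδ₁
    have h := QKernel.predError_le μ hA hρh hρA hρm hk hkm hN lam
      (QKernel.one_le_log_four_div hδ (hδδ₁.trans_lt hδ₁))
    have e : 4 * Real.exp (-Real.log (4 / δ)) = δ := by
      rw [Real.exp_neg, Real.exp_log (by positivity)]
      field_simp
    rw [e] at h
    refine h.trans (measure_mono fun x hx c hc htr hu => (hx c hc htr hu).trans ?_)
    have hL : √(Real.log (4 / δ) / N) ≤ √κ * √(Real.log (1 / δ) / N) := by
      rw [← Real.sqrt_mul (by linarith), ← mul_div_assoc]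
      apply Real.sqrt_le_sqrt
      gcongr
      exact QKernel.log_four_div_le hδ hδδ₁ hδ₁
    set a := √(QKernel.pairTrace (QKernel.Atra (QKernel.scale c k) lam ρ x) A / N)
    set b := √(QKernel.pairTrace (QKernel.Agen (QKernel.scale c k) lam ρ x) A / N)
    have hab : a + b ≤ √κ * (a + b) :=
      le_mul_of_one_le_left (add_nonneg (Real.sqrt_nonneg _) (Real.sqrt_nonneg _)) hsκ
    linarith
  refine ⟨fun lam _ δ hδ hδδ₀ => ?_, fun x c hu => ⟨QKernel.Atra_zero _ _ _,
    QKernel.Agen_zero hu ρ, QKernel.pairTrace_Agen_zero hu hA hρh⟩, ?_⟩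
  · refine (bound lam δ hδ (hδδ₀.trans (le_max_left _ _))).trans
      (measure_mono fun x hx c hc htr hu => (hx c hc htr hu).trans ?_)
    exact mul_le_mul_of_nonneg_right (le_mul_of_one_le_right (by positivity) hM) (by positivity)
  · have h := bound 0 0.01 (by norm_num) (le_max_of_le_right (by norm_num))
    rw [show (1 : ℝ) - 0.01 = 0.99 by norm_num, show (1 : ℝ) / 0.01 = 100 by norm_num] at h
    refine h.trans (measure_mono fun x hx c hc htr hu => ?_)
    refine (hx c hc htr (by rwa [QKernel.regGram_zero])).trans ?_
    rw [QKernel.Atra_zero, QKernel.pairTrace_Agen_zero hu hA hρh]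
    set s := QKernel.sK (QKernel.scale c k) ρ A x
    have h0 : √(QKernel.pairTrace (0 : Matrix (d × d) (d × d) ℂ) A / N) = 0 := by
      simp [QKernel.pairTrace]
    have h1 : √(s / N) ≤ √(max 1 s / N) := by
      gcongr
      exact le_max_right _ _
    have h2 : √(Real.log 100 / N) ≤ √(Real.log 100) * √(max 1 s / N) := by
      rw [← Real.sqrt_mul (Real.log_nonneg (by norm_num)), ← mul_div_assoc]
      apply Real.sqrt_le_sqrt
      gcongr
      exact le_mul_of_one_le_right (Real.log_nonneg (by norm_num)) (le_max_left _ _)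
    rw [h0, zero_add, mul_assoc (42 * √κ)]
    gcongr
    rw [hMdef, add_mul, one_mul]
    exact add_le_add h1 h2
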